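/- Theorem 5.4. For a proper function $\varphi:\mathbb R^n\to(-\infty,\infty]$, write $\operatorname{dom}\varphi=\{x\mid\varphi(x)<\infty\}$. For $x\in\operatorname{dom}\varphi$, let the regular subdifferential be $$\widehat\partial\varphi(x)=\Big\{v\;\Big|\;\liminf_{u\to x,\,u\ne x}\frac{\varphi(u)-\varphi(x)-\langle v,u-x\rangle}{\|u-x\|}\ge 0\Big\},$$ and let the limiting subdifferential $\partial\varphi(x)$ be the set of all limits of sequences $v_k\in\widehat\partial\varphi(x_k)$ with $x_k\to x$ and $\varphi(x_k)\to\varphi(x)$; both sets are empty if $x\notin\operatorname{dom}\varphi$. Let $\operatorname{gph}\partial\varphi=\{(x,v)\mid v\in\partial\varphi(x)\}\subset\mathbb R^n\times\mathbb R^n$. For a set $\Omega$ with indicator function $\delta_\Omega$ ($0$ on $\Omega$, $\infty$ elsewhere), let $\widehat N_\Omega(p)=\widehat\partial\delta_\Omega(p)$ and $N_\Omega(p)=\partial\delta_\Omega(p)$. For $(x,y)\in\operatorname{gph}\partial\varphi$ and $w\in\mathbb R^n$, define the combined and the limiting second-order subdifferentials $$\breve\partial^2\varphi(x,y)(w)=\{z\mid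 (z,-w)\in\widehat N_{\operatorname{gph}\partial\varphi}(x,y)\},\qquad \partial^2\varphi(x,y)(w)=\{z\mid (z,-w)\in N_{\operatorname{gph}\partial\varphi}(x,y)\}.$$ Let $\mathbb B_\epsilon(a)$ be the closed ball with center $a$ and radius $\epsilon$. Let $\bar x\in\operatorname{dom}\varphi$ and $\bar v\in\partial\varphi(\bar x)$. * $\varphi$ is subdifferentially continuous at $\bar x$ for $\bar v$ if for every $\epsilon>0$ there is $\delta>0$ such that $|\varphi(x)-\varphi(\bar x)|<\epsilon$ whenever $(x,v)\in\operatorname{gph}\partial\varphi\cap(\mathbb B_\delta(\bar x)\times\mathbb B_\delta(\bar v))$. * $\varphi$ is prox-regular at $\bar x$ for $\bar v$ if it is lower semicontinuous and there are $\epsilon>0$ and $r\ge0$ such that $\varphi(x)\ge\varphi(u)+\langle v,x-u\rangle-\frac r2\|x-u\|^2$ for all $x\in\mathbb B_\epsilon(\bar x)$ and all $(u,v)\in\operatorname{gph}\partial\varphi\cap(\mathbb B_\epsilon(\bar x)\times\mathbb B_\epsilon(\bar v))$ with $\varphi(u)<\varphi(\bar x)+\epsilon$. * $\varphi$ is variationally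 strongly convex at $\bar x$ for $\bar v$ with modulus $\sigma>0$ if it is lower semicontinuous and there are convex neighborhoods $U$ of $\bar x$ and $V$ of $\bar v$, a proper lower semicontinuous function $\psi:\mathbb R^n\to(-\infty,\infty]$ with $\psi\le\varphi$ on $U$ and $$\psi((1-t)x+ty)\le(1-t)\psi(x)+t\psi(y)-\tfrac\sigma2t(1-t)\|x-y\|^2\quad\text{for all }x,y\in U,\ t\in[0,1],$$ and a number $\epsilon>0$ such that, with $U_\epsilon=\{x\in U\mid\varphi(x)<\varphi(\bar x)+\epsilon\}$, one has $(U_\epsilon\times V)\cap\operatorname{gph}\partial\varphi=(U\times V)\cap\operatorname{gph}\partial\psi$ and $\varphi(x)=\psi(x)$ for every element $(x,v)$ of this set. Let $\sigma>0$, and suppose that $\varphi$ is subdifferentially continuous at $\bar x$ for $\bar v$. Then the following assertions are equivalent: (i) $\varphi$ is variationally strongly convex at $\bar x$ for $\bar v$ with modulus $\sigma$. (ii) $\varphi$ is prox-regular at $\bar x$ for $\bar v$, and there are neighborhoods $U$ of $\bar x$ and $V$ of $\bar v$ such that $$\langle z,w\rangle\ge\sigma\|w\|^2\quad\text{whenever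 } z\in\breve\partial^2\varphi(x,y)(w),\ (x,y)\in\operatorname{gph}\partial\varphi\cap(U\times V),\ w\in\mathbb R^n.$$ (iii) $\varphi$ is prox-regular at $\bar x$ for $\bar v$, and there are neighborhoods $U$ of $\bar x$ and $V$ of $\bar v$ such that $$\langle z,w\rangle\ge\sigma\|w\|^2\quad\text{whenever } z\in\partial^2\varphi(x,y)(w),\ (x,y)\in\operatorname{gph}\partial\varphi\cap(U\times V),\ w\in\mathbb R^n.$$ -/

import Mathlib

open Filter Topology

namespace VarAnalysis

section Subdifferentials

variable {H : Type*} [NormedAddCommGroup H] [InnerProductSpace ℝ H]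

/-- The effective domain `{x | φ x < ∞}` of an extended-real-valued function. -/
def dom (φ : H → EReal) : Set H := {x | φ x < ⊤}

/-- A proper function: its effective domain is nonempty and it never takes the value `-∞`. -/
def IsProper (φ : H → EReal) : Prop := (dom φ).Nonempty ∧ ∀ x, φ x ≠ ⊥

/-- The Fréchet (regular) subdifferential of `φ` at `a`: the set of `v` such that
`liminf_{x → a, x ≠ a} (φ x - φ a - ⟨v, x - a⟩) / ‖x - a‖ ≥ 0`; empty if `a ∉ dom φ`. -/
def regSubdiff (φ : H → EReal) (a : H) : Set H :=
  {v | a ∈ dom φ ∧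
    0 ≤ liminf (fun x : H => (φ x - φ a - ((inner ℝ v (x - a) : ℝ) : EReal)) /
      ((‖x - a‖ : ℝ) : EReal)) (𝓝[≠] a)}

/-- The Mordukhovich (limiting) subdifferential of `φ` at `a`: the outer limit of
`regSubdiff φ x` as `x → a` with `φ x → φ a`; empty if `a ∉ dom φ`. -/
def limSubdiff (φ : H → EReal) (a : H) : Set H :=
  {v | a ∈ dom φ ∧ ∃ (x y : ℕ → H), Tendsto x atTop (𝓝 a) ∧
    Tendsto (fun k => φ (x k)) atTop (𝓝 (φ a)) ∧
    (∀ k, y k ∈ regSubdiff φ (x k)) ∧ Tendsto y atTop (𝓝 v)}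

open Classical in
/-- The indicator function of a set: `0` on the set and `∞` outside. -/
noncomputable def indicatorFun (Ω : Set H) (x : H) : EReal := if x ∈ Ω then 0 else ⊤

/-- The regular normal cone to `Ω` at `a` (empty if `a ∉ Ω`). -/
def regNormalCone (Ω : Set H) (a : H) : Set H := regSubdiff (indicatorFun Ω) a

/-- The limiting normal cone to `Ω` at `a` (empty if `a ∉ Ω`). -/
def limNormalCone (Ω : Set H) (a : H) : Set H := limSubdiff (indicatorFun Ω) a

end Subdifferentials

section Coderivatives

variable {X Y : Type*} [NormedAddCommGroup X] [InnerProductSpace ℝ X]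
  [NormedAddCommGroup Y] [InnerProductSpace ℝ Y]

/-- The graph of a set-valued mapping, as a subset of the product `X × Y` equipped with its
Euclidean (`ℓ²`) inner product. -/
def gph (F : X → Set Y) : Set (WithLp 2 (X × Y)) := {p | p.snd ∈ F p.fst}

/-- The regular coderivative of `F` at `(a, b)`. -/
def regCoderiv (F : X → Set Y) (a : X) (b : Y) (v : Y) : Set X :=
  {u | WithLp.toLp 2 (u, -v) ∈ regNormalCone (gph F) (WithLp.toLp 2 (a, b))}

/-- The limiting coderivative of `F` at `(a, b)`. -/
def limCoderiv (F : X → Set Y) (a : X) (b : Y) (v : Y) : Set X :=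
  {u | WithLp.toLp 2 (u, -v) ∈ limNormalCone (gph F) (WithLp.toLp 2 (a, b))}

end Coderivatives

section SecondOrder

variable {H : Type*} [NormedAddCommGroup H] [InnerProductSpace ℝ H]

/-- The combined second-order subdifferential of `φ` at `x` relative to `y`: the regular
coderivative of the limiting subdifferential mapping. -/
def combinedSubdiff2 (φ : H → EReal) (x y : H) (w : H) : Set H :=
  regCoderiv (limSubdiff φ) x y w

/-- The limiting second-order subdifferential of `φ` at `x` relative to `y`: the limiting
coderivative of the limiting subdifferential mapping. -/
def limSubdiff2 (φ : H → EReal) (x y : H) (w : H) : Set H :=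
  limCoderiv (limSubdiff φ) x y w

/-- Subdifferential continuity of `φ` at `a` for `b ∈ ∂φ(a)`. The two strict inequalities say
`|φ x - φ a| < ε`. -/
def SubdiffContinuousAt (φ : H → EReal) (a b : H) : Prop :=
  b ∈ limSubdiff φ a ∧
  ∀ ε : ℝ, 0 < ε → ∃ δ : ℝ, 0 < δ ∧ ∀ x ∈ Metric.closedBall a δ, ∀ v ∈ Metric.closedBall b δ,
    v ∈ limSubdiff φ x → φ x < φ a + (ε : EReal) ∧ φ a < φ x + (ε : EReal)

/-- Prox-regularity of the lower semicontinuous function `φ` at `a` for `b ∈ ∂φ(a)`. -/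
def ProxRegularAt (φ : H → EReal) (a b : H) : Prop :=
  LowerSemicontinuous φ ∧ b ∈ limSubdiff φ a ∧
  ∃ ε r : ℝ, 0 < ε ∧ 0 ≤ r ∧
    ∀ x ∈ Metric.closedBall a ε, ∀ u ∈ Metric.closedBall a ε, ∀ v ∈ Metric.closedBall b ε,
      v ∈ limSubdiff φ u → φ u < φ a + (ε : EReal) →
      φ u + ((inner ℝ v (x - u) - r / 2 * ‖x - u‖ ^ 2 : ℝ) : EReal) ≤ φ x

/-- Strong convexity with modulus `κ` of a function `ψ` with values in `(-∞, ∞]` on the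
set `U`. -/
def StrongConvexOnE (ψ : H → EReal) (U : Set H) (κ : ℝ) : Prop :=
  Convex ℝ U ∧ ∀ x ∈ U, ∀ y ∈ U, ∀ t : ℝ, 0 ≤ t → t ≤ 1 →
    ψ ((1 - t) • x + t • y) ≤ ((1 - t : ℝ) : EReal) * ψ x + (t : EReal) * ψ y
      - ((κ / 2 * t * (1 - t) * ‖x - y‖ ^ 2 : ℝ) : EReal)

/-- Variational strong convexity with modulus `σ` of the lower semicontinuous function `φ` at `a`
for `b ∈ ∂φ(a)`: there are a convex neighborhood `U × V` of `(a, b)`, a proper lower semicontinuous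
function `ψ` which is strongly convex on `U` with modulus `σ` and satisfies `ψ ≤ φ` on `U`, and a
number `ε > 0` such that, for `U_ε = {x ∈ U | φ x < φ a + ε}`, the sets `(U_ε × V) ∩ gph ∂φ` and
`(U × V) ∩ gph ∂ψ` coincide and `φ x = ψ x` at their common elements `(x, v)`. -/
def VarStrongConvexAt (φ : H → EReal) (a b : H) (σ : ℝ) : Prop :=
  LowerSemicontinuous φ ∧ b ∈ limSubdiff φ a ∧
  ∃ U ∈ 𝓝 a, ∃ V ∈ 𝓝 b, Convex ℝ U ∧ Convex ℝ V ∧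
  ∃ ψ : H → EReal, IsProper ψ ∧ LowerSemicontinuous ψ ∧ StrongConvexOnE ψ U σ ∧
    (∀ x ∈ U, ψ x ≤ φ x) ∧
  ∃ ε : ℝ, 0 < ε ∧
    {p : WithLp 2 (H × H) | p.fst ∈ U ∧ φ p.fst < φ a + (ε : EReal) ∧ p.snd ∈ V} ∩
        gph (limSubdiff φ) =
      {p : WithLp 2 (H × H) | p.fst ∈ U ∧ p.snd ∈ V} ∩ gph (limSubdiff ψ) ∧
    ∀ p ∈ {p : WithLp 2 (H × H) | p.fst ∈ U ∧ p.snd ∈ V} ∩ gph (limSubdiff ψ),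
      φ p.fst = ψ p.fst

end SecondOrder

end VarAnalysis

namespace VarAnalysis

/-! ### Finite values, indicator functions, and norms on the product. -/

section Auxiliary

variable {X Y : Type*}

/-! Both implications between the variational and the combined second-order condition rest on one
reflection: `κ‖Δu‖² ≤ ⟨Δv, Δu⟩` says exactly that `2κu - v` is a nonexpansive function of `v`, and
`σ‖w‖² ≤ ⟨z, w⟩` says exactly that `‖z - 2σw‖ ≤ ‖z‖`.

From variational strong convexity, the subdifferential of `ψ` is strongly monotone with modulus `σ`,
and tilted minimization makes it locally onto. Moving `y` along `q = z - 2σw` yields graph points at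
which the coderivative inequality and nonexpansiveness of the reflection together force `‖q‖ ≤ ‖z‖`
(`le_inner_of_mem_regCoderiv_of_strongConvexOn`).

Conversely, prox-regularity and subdifferential continuity give `∂φ + ρ(· - a)` a single-valued
Lipschitz local inverse `g`. Regular subgradients of the scalarizations `⟨z, 2(σ+ρ)g - id⟩`
correspond to regular coderivatives of `∂φ`, so the second-order inequality bounds them by `‖z‖`. A
mean value estimate turns this into nonexpansiveness, hence cocoercivity of `g` with modulus `σ + ρ`
(`cocoercive_of_le_inner_regCoderiv`). Conjugate duality then converts smoothness of the local
conjugate into quadratic growth of `φ + ρ/2‖· - a‖²`; removing the `ρ` term leaves growth of `φ`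
with modulus `σ` (`exists_quadratic_growth_of_le_inner`). The supremum of the resulting quadratic
minorants is the required `ψ`; its subdifferential has no extra local elements because that of `φ`
is already locally onto (`varStrongConvexAt_of_quadratic_growth`).

The limiting condition contains the combined one by inclusion of normal cones and follows from it by
passing to the limit. -/

theorem exists_coe_of_mem_dom {φ : X → EReal} {a : X} (hbot : φ a ≠ ⊥) (ha : a ∈ dom φ) :
    ∃ α : ℝ, φ a = α :=
  ⟨(φ a).toReal, (EReal.coe_toReal (ne_of_lt ha) hbot).symm⟩

theorem indicatorFun_ne_bot (Ω : Set X) (a : X) : indicatorFun Ω a ≠ ⊥ := by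
  unfold indicatorFun; split_ifs <;> simp

theorem mem_dom_indicatorFun {Ω : Set X} {a : X} : a ∈ dom (indicatorFun Ω) ↔ a ∈ Ω := by
  unfold dom indicatorFun
  by_cases h : a ∈ Ω <;> simp [h]

theorem prodL2_norm_le_add [NormedAddCommGroup X] [NormedAddCommGroup Y]
    (p : WithLp 2 (X × Y)) : ‖p‖ ≤ ‖p.fst‖ + ‖p.snd‖ := by
  rw [WithLp.prod_norm_eq_of_L2]
  refine Real.sqrt_le_iff.2 ⟨by positivity, ?_⟩
  nlinarith [norm_nonneg p.fst, norm_nonneg p.snd]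

theorem prodL2_add_le_norm [NormedAddCommGroup X] [NormedAddCommGroup Y]
    (p : WithLp 2 (X × Y)) : ‖p.fst‖ + ‖p.snd‖ ≤ 2 * ‖p‖ := by
  rw [WithLp.prod_norm_eq_of_L2]
  have h1 : ‖p.fst‖ ≤ √(‖p.fst‖ ^ 2 + ‖p.snd‖ ^ 2) := Real.le_sqrt_of_sq_le (by nlinarith)
  have h2 : ‖p.snd‖ ≤ √(‖p.fst‖ ^ 2 + ‖p.snd‖ ^ 2) := Real.le_sqrt_of_sq_le (by nlinarith)
  linarith

end Auxiliary

/-! ### Epsilon forms of regular subgradients and regular normals. -/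

section Characterizations

variable {H : Type*} [NormedAddCommGroup H] [InnerProductSpace ℝ H]

theorem mem_regSubdiff_iff {φ : H → EReal} {a v : H} (hbot : φ a ≠ ⊥) :
    v ∈ regSubdiff φ a ↔ a ∈ dom φ ∧ ∀ ε : ℝ, 0 < ε → ∀ᶠ x in 𝓝 a,
      φ a + ((inner ℝ v (x - a) - ε * ‖x - a‖ : ℝ) : EReal) ≤ φ x := by
  refine and_congr_right fun ha => ?_
  obtain ⟨α, hα⟩ := exists_coe_of_mem_dom hbot ha
  rw [le_liminf_iff]
  constructor
  · intro h ε hε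
    have h1 := h ((-ε : ℝ) : EReal) (by exact_mod_cast neg_lt_zero.2 hε)
    rw [eventually_nhdsWithin_iff] at h1
    filter_upwards [h1] with x hx
    by_cases hxa : x = a
    · subst hxa; simp
    have hpos : 0 < ‖x - a‖ := norm_pos_iff.2 (sub_ne_zero.2 hxa)
    have h2 := hx hxa
    rw [EReal.lt_div_iff (by exact_mod_cast hpos) (EReal.coe_ne_top _), hα] at h2
    rw [hα]
    induction hφ : φ x with
    | bot => rw [hφ] at h2; simp at h2
    | top => exact le_top
    | coe y =>
      rw [hφ] at h2
      norm_cast at h2 ⊢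
      linarith
  · intro h y hy
    -- For the threshold `⊥` it suffices that the quotient is not `⊥`, which any fixed `ε` ensures.
    rcases eq_or_ne y ⊥ with rfl | hyb
    · rw [eventually_nhdsWithin_iff]
      filter_upwards [h 1 one_pos] with x hx hxa
      have hpos : 0 < ‖x - a‖ := norm_pos_iff.2 (sub_ne_zero.2 hxa)
      rw [hα] at hx ⊢
      rw [EReal.lt_div_iff (by exact_mod_cast hpos) (EReal.coe_ne_top _),
        EReal.bot_mul_coe_of_pos hpos]
      induction hφ : φ x with
      | bot => rw [hφ, ← EReal.coe_add] at hx; exact absurd (le_bot_iff.1 hx) (EReal.coe_ne_bot _)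
      | top => simp
      | coe y => rw [← EReal.coe_sub, ← EReal.coe_sub]; exact EReal.bot_lt_coe _
    · lift y to ℝ using ⟨ne_top_of_lt hy, hyb⟩
      have hy' : y < 0 := by exact_mod_cast hy
      rw [eventually_nhdsWithin_iff]
      -- Halving the slack makes the quotient at least `y / 2`, strictly above the negative `y`.
      filter_upwards [h (-y / 2) (by linarith)] with x hx hxa
      have hpos : 0 < ‖x - a‖ := norm_pos_iff.2 (sub_ne_zero.2 hxa)
      rw [hα] at hx ⊢
      rw [EReal.lt_div_iff (by exact_mod_cast hpos) (EReal.coe_ne_top _)]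
      induction hφ : φ x with
      | bot => rw [hφ, ← EReal.coe_add] at hx; exact absurd (le_bot_iff.1 hx) (EReal.coe_ne_bot _)
      | top =>
        rw [EReal.top_sub_coe, EReal.top_sub_coe]
        exact_mod_cast EReal.coe_lt_top (y * ‖x - a‖)
      | coe z =>
        rw [hφ] at hx
        norm_cast at hx ⊢
        nlinarith

theorem regSubdiff_subset_limSubdiff (φ : H → EReal) (a : H) :
    regSubdiff φ a ⊆ limSubdiff φ a := fun v hv =>
  ⟨hv.1, fun _ => a, fun _ => v, tendsto_const_nhds, tendsto_const_nhds, fun _ => hv,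
    tendsto_const_nhds⟩

theorem mem_regNormalCone_iff {Ω : Set H} {a p : H} :
    p ∈ regNormalCone Ω a ↔ a ∈ Ω ∧ ∀ ε : ℝ, 0 < ε → ∀ᶠ x in 𝓝 a, x ∈ Ω →
      inner ℝ p (x - a) ≤ ε * ‖x - a‖ := by
  rw [regNormalCone, mem_regSubdiff_iff (indicatorFun_ne_bot Ω a), mem_dom_indicatorFun]
  refine and_congr_right fun ha => forall₂_congr fun ε _ => eventually_congr (.of_forall fun x => ?_)
  by_cases hx : x ∈ Ω
  · simp only [indicatorFun, ha, hx, if_true, zero_add, forall_true_left]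
    norm_cast
    rw [sub_nonpos]
  · simp [indicatorFun, hx]

theorem regNormalCone_subset_limNormalCone (Ω : Set H) (a : H) :
    regNormalCone Ω a ⊆ limNormalCone Ω a :=
  regSubdiff_subset_limSubdiff _ _

theorem exists_seq_of_mem_limNormalCone {Ω : Set H} {a p : H} (hp : p ∈ limNormalCone Ω a) :
    ∃ x q : ℕ → H, Tendsto x atTop (𝓝 a) ∧ Tendsto q atTop (𝓝 p) ∧
      ∀ k, q k ∈ regNormalCone Ω (x k) := by
  obtain ⟨-, x, q, hx, -, hq, hqp⟩ := hp
  exact ⟨x, q, hx, hqp, hq⟩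

end Characterizations

/-! ### Regular and limiting coderivatives. -/

section Coderivative

variable {X Y : Type*} [NormedAddCommGroup X] [InnerProductSpace ℝ X]
  [NormedAddCommGroup Y] [InnerProductSpace ℝ Y]

/-- The `ℓ²` norm of a pair and the sum of the norms of its entries differ by at most a factor 2,
which is absorbed into `ε` and `δ`; errors can then be estimated coordinatewise. -/
theorem mem_regCoderiv_iff {F : X → Set Y} {a z : X} {b w : Y} :
    z ∈ regCoderiv F a b w ↔ b ∈ F a ∧ ∀ ε : ℝ, 0 < ε → ∃ δ : ℝ, 0 < δ ∧
      ∀ x y, y ∈ F x → ‖x - a‖ < δ → ‖y - b‖ < δ →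
        inner ℝ z (x - a) - inner ℝ w (y - b) ≤ ε * (‖x - a‖ + ‖y - b‖) := by
  change WithLp.toLp 2 (z, -w) ∈ regNormalCone (gph F) (WithLp.toLp 2 (a, b)) ↔ _
  rw [mem_regNormalCone_iff]
  refine and_congr Iff.rfl ⟨fun h ε hε => ?_, fun h ε hε => ?_⟩
  · obtain ⟨δ, hδ, h1⟩ := Metric.eventually_nhds_iff.1 (h ε hε)
    refine ⟨δ / 2, by positivity, fun x y hxy hx hy => ?_⟩
    have hn : ‖WithLp.toLp 2 (x, y) - WithLp.toLp 2 (a, b)‖ ≤ ‖x - a‖ + ‖y - b‖ :=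
      prodL2_norm_le_add _
    have h2 := h1 (y := WithLp.toLp 2 (x, y)) (by rw [dist_eq_norm]; linarith) hxy
    rw [WithLp.prod_inner_apply] at h2
    simp only [WithLp.ofLp_sub, Prod.fst_sub, Prod.snd_sub, inner_neg_left] at h2
    rw [sub_eq_add_neg]
    exact h2.trans (by gcongr)
  · obtain ⟨δ, hδ, h1⟩ := h (ε / 2) (by positivity)
    refine Metric.eventually_nhds_iff.2 ⟨δ / 2, by positivity, fun q hq hqF => ?_⟩
    have hn : ‖q.fst - a‖ + ‖q.snd - b‖ ≤ 2 * ‖q - WithLp.toLp 2 (a, b)‖ :=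
      prodL2_add_le_norm (q - WithLp.toLp 2 (a, b))
    rw [dist_eq_norm] at hq
    have h2 := h1 q.fst q.snd hqF
      (by linarith [norm_nonneg (q.snd - b)]) (by linarith [norm_nonneg (q.fst - a)])
    rw [WithLp.prod_inner_apply]
    simp only [WithLp.ofLp_sub, Prod.fst_sub, Prod.snd_sub, inner_neg_left]
    calc _ = _ := (sub_eq_add_neg _ _).symm
      _ ≤ _ := h2
      _ ≤ ε / 2 * (2 * ‖q - WithLp.toLp 2 (a, b)‖) := by gcongr
      _ = _ := by ring

/-- A quadratic lower bound on the regular coderivatives of `F` along an open set of the graph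
passes to the limiting coderivatives. -/
theorem le_inner_of_mem_limCoderiv {F : X → Set X} {σ : ℝ} {U V : Set X}
    (h : ∀ x ∈ U, ∀ y ∈ V, y ∈ F x → ∀ w, ∀ z ∈ regCoderiv F x y w,
      σ * ‖w‖ ^ 2 ≤ inner ℝ z w)
    {x y z w : X} (hx : U ∈ 𝓝 x) (hy : V ∈ 𝓝 y) (hz : z ∈ limCoderiv F x y w) :
    σ * ‖w‖ ^ 2 ≤ inner ℝ z w := by
  obtain ⟨p, q, hp, hq, hpq⟩ := exists_seq_of_mem_limNormalCone hz
  have hp1 : Tendsto (fun k => (p k).fst) atTop (𝓝 x) :=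
    ((WithLp.prod_continuous_ofLp 2 X X).fst.tendsto _).comp hp
  have hp2 : Tendsto (fun k => (p k).snd) atTop (𝓝 y) :=
    ((WithLp.prod_continuous_ofLp 2 X X).snd.tendsto _).comp hp
  have hq1 : Tendsto (fun k => (q k).fst) atTop (𝓝 z) :=
    ((WithLp.prod_continuous_ofLp 2 X X).fst.tendsto _).comp hq
  have hq2 : Tendsto (fun k => -(q k).snd) atTop (𝓝 w) := by
    have := (((WithLp.prod_continuous_ofLp 2 X X).snd.tendsto _).comp hq).neg
    simpa [Function.comp_def] using this
  refine le_of_tendsto_of_tendsto ((hq2.norm.pow 2).const_mul σ) (hq1.inner hq2) ?_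
  filter_upwards [hp1 hx, hp2 hy] with k hk1 hk2
  refine h _ hk1 _ hk2 (mem_regNormalCone_iff.1 (hpq k)).1 _ _ ?_
  change WithLp.toLp 2 ((q k).fst, - -(q k).snd) ∈ regNormalCone (gph F) _
  rw [neg_neg]
  exact hpq k

end Coderivative

/-! ### A substitute for integrating derivatives. -/

section Scalar

/-- A function whose increments over subintervals are bounded above by a constant times the
square of their length does not increase. -/
theorem le_of_forall_sub_le_sq {G : ℝ → ℝ} {C : ℝ}
    (h : ∀ s t, 0 ≤ s → s ≤ t → t ≤ 1 → G t - G s ≤ C * (t - s) ^ 2) :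
    G 1 ≤ G 0 := by
  -- Splitting into `n + 1` equal pieces gives `n + 1` errors `C / (n + 1) ^ 2`, whose sum vanishes
  -- in the limit.
  have key (n : ℕ) : G 1 - G 0 ≤ C * (1 / ((n : ℝ) + 1)) := by
    have hn0 : (0 : ℝ) < (n : ℝ) + 1 := by positivity
    have hsum := Finset.sum_range_sub (fun i : ℕ => G ((i : ℝ) / ((n : ℝ) + 1))) (n + 1)
    have h1 : ((n + 1 : ℕ) : ℝ) / ((n : ℝ) + 1) = 1 := by push_cast; field_simp
    rw [h1, Nat.cast_zero, zero_div] at hsum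
    rw [← hsum]
    calc _ ≤ ∑ i ∈ Finset.range (n + 1), C * (1 / ((n : ℝ) + 1)) ^ 2 := by
          refine Finset.sum_le_sum fun i hi => ?_
          have hi' : ((i + 1 : ℕ) : ℝ) ≤ (n : ℝ) + 1 := by
            exact_mod_cast Finset.mem_range.1 hi
          have hd : ((i + 1 : ℕ) : ℝ) / ((n : ℝ) + 1) - (i : ℝ) / ((n : ℝ) + 1)
              = 1 / ((n : ℝ) + 1) := by push_cast; ring
          rw [← hd]
          refine h _ _ (by positivity) ?_ ((div_le_one hn0).2 hi')
          gcongr; simp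
      _ = _ := by
          rw [Finset.sum_const, Finset.card_range, nsmul_eq_mul]
          push_cast
          field_simp
  have hlim : Tendsto (fun n : ℕ => C * (1 / ((n : ℝ) + 1))) atTop (𝓝 (C * 0)) :=
    tendsto_one_div_add_atTop_nhds_zero_nat.const_mul C
  have := ge_of_tendsto' hlim key
  linarith

end Scalar

/-! ### A mean value inequality from bounds on regular subgradients. -/

section Lipschitz

variable {H : Type*} [NormedAddCommGroup H] [InnerProductSpace ℝ H]

/-- First-order optimality: at a local minimizer of `θ + N` with `N` differentiable, the negative
gradient of `N` is a regular subgradient of `θ`. -/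
theorem eventually_le_of_isLocalMin_add {θ N : H → ℝ} {u q : H}
    (hmin : ∀ᶠ x in 𝓝 u, θ u + N u ≤ θ x + N x)
    (hN : HasFDerivAt N (innerSL ℝ q) u) {ε : ℝ} (hε : 0 < ε) :
    ∀ᶠ x in 𝓝 u, θ u + inner ℝ (-q) (x - u) - ε * ‖x - u‖ ≤ θ x := by
  have h1 := (hasFDerivAt_iff_isLittleO.1 hN).def hε
  filter_upwards [hmin, h1] with x hx hx1
  rw [Real.norm_eq_abs, innerSL_apply_apply] at hx1
  have := (abs_le.1 hx1).2
  rw [inner_neg_left]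
  linarith

theorem hasFDerivAt_norm_sub_add_sq {x u : H} (hux : u ≠ x) (L K : ℝ) :
    HasFDerivAt (fun y => L * ‖y - x‖ + K * ‖y - x‖ ^ 2)
      (innerSL ℝ ((L / ‖u - x‖ + 2 * K) • (u - x))) u := by
  have hpos : ‖u - x‖ ≠ 0 := norm_ne_zero_iff.2 (sub_ne_zero.2 hux)
  have hsq : HasFDerivAt (fun y => ‖y - x‖ ^ 2) ((2 : ℝ) • innerSL ℝ (u - x)) u := by
    have := ((hasFDerivAt_id (𝕜 := ℝ) u).sub_const x).norm_sq
    refine this.congr_fderiv ?_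
    ext y; simp
  have hn : HasFDerivAt (fun y => ‖y - x‖) ((1 / ‖u - x‖) • innerSL ℝ (u - x)) u := by
    have := hsq.sqrt (by positivity)
    simp only [Real.sqrt_sq (norm_nonneg _)] at this
    refine this.congr_fderiv ?_
    rw [smul_smul]; congr 1; field_simp
  refine ((hn.const_mul L).add (hsq.const_mul K)).congr_fderiv ?_
  ext y; simp only [add_apply, smul_apply, innerSL_apply_apply, smul_eq_mul, inner_smul_left]
  simp; ring

variable [ProperSpace H]

/-- A function that is Lipschitz on a ball and whose regular subgradients there are bounded by `L`
is `L`-Lipschitz on a smaller ball. -/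
theorem sub_le_of_regular_subgradients_bounded {θ : H → ℝ} {b : H} {R L M : ℝ} (hR : 0 < R)
    (hL : 0 ≤ L) (hM : 0 ≤ M)
    (hlip : ∀ x ∈ Metric.ball b R, ∀ y ∈ Metric.ball b R, θ x - θ y ≤ M * ‖x - y‖)
    (hsub : ∀ x ∈ Metric.ball b R, ∀ p : H,
      (∀ ε : ℝ, 0 < ε → ∀ᶠ y in 𝓝 x, θ x + inner ℝ p (y - x) - ε * ‖y - x‖ ≤ θ y) → ‖p‖ ≤ L)
    {x y : H} (hx : x ∈ Metric.ball b (R / 4)) (hy : y ∈ Metric.ball b (R / 4)) :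
    θ x - θ y ≤ L * ‖x - y‖ := by
  have hcont : ContinuousOn θ (Metric.ball b R) := by
    refine (LipschitzOnWith.of_dist_le_mul (K := ⟨M, hM⟩) fun u hu v hv => ?_).continuousOn
    rw [Real.dist_eq, dist_eq_norm, abs_le]
    have h1 := hlip u hu v hv
    have h2 := hlip v hv u hu
    rw [norm_sub_rev] at h2
    constructor
    · change -(M * _) ≤ _; linarith
    · exact h1
  -- On the sphere of radius `R / 2` the penalty `K‖w - u‖²` equals `(M + 1)‖w - u‖`, which exceeds
  -- any decrease allowed by the Lipschitz constant `M`; the minimizer below is therefore interior.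
  set K : ℝ := 2 * (M + 1) / R with hK
  have hKR : K * (R / 2) = M + 1 := by rw [hK]; field_simp
  have hK0 : 0 < K := by positivity
  -- The penalized function is minimized at `u` itself: a minimizer `w ≠ u` would carry a regular
  -- subgradient of `θ` of norm `L' + 2K‖w - u‖ > L`.
  have step : ∀ L' > L, ∀ u ∈ Metric.ball b (R / 2), ∀ v, ‖v - u‖ ≤ R / 2 →
      θ u ≤ θ v + (L' * ‖v - u‖ + K * ‖v - u‖ ^ 2) := by
    intro L' hL' u hu v hv
    have hsubset : Metric.closedBall u (R / 2) ⊆ Metric.ball b R := fun w hw => by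
      rw [Metric.mem_ball] at hu ⊢
      have := dist_triangle w u b
      have := Metric.mem_closedBall.1 hw
      linarith
    obtain ⟨w, hw, hmin⟩ := (isCompact_closedBall u (R / 2)).exists_isMinOn
      (f := fun y => θ y + (L' * ‖y - u‖ + K * ‖y - u‖ ^ 2))
      ⟨u, Metric.mem_closedBall_self (by positivity)⟩
      ((hcont.mono hsubset).add (by fun_prop))
    have hmin' : ∀ y, ‖y - u‖ ≤ R / 2 → θ w + (L' * ‖w - u‖ + K * ‖w - u‖ ^ 2)
        ≤ θ y + (L' * ‖y - u‖ + K * ‖y - u‖ ^ 2) := fun y hy =>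
      hmin (mem_closedBall_iff_norm.2 hy)
    suffices hwu : w = u by
      have := hmin' v hv
      rw [hwu] at this
      simpa using this
    by_contra hne
    have hpos : 0 < ‖w - u‖ := norm_pos_iff.2 (sub_ne_zero.2 hne)
    have hu' := hmin' u (by simp; positivity)
    have hlt : ‖w - u‖ < R / 2 := by
      refine lt_of_le_of_ne (mem_closedBall_iff_norm.1 hw) fun heq => ?_
      have h1 := hlip u (hsubset (Metric.mem_closedBall_self (by positivity))) w (hsubset hw)
      rw [norm_sub_rev] at h1
      simp only [sub_self, norm_zero] at hu'
      have h2 : K * ‖w - u‖ ^ 2 = (M + 1) * ‖w - u‖ := by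
        rw [sq, ← mul_assoc]; nth_rw 1 [heq]; rw [hKR]
      have h3 : 0 < L' * ‖w - u‖ := mul_pos (by linarith) hpos
      nlinarith
    have hp := hsub w (hsubset hw) _ fun ε hε => eventually_le_of_isLocalMin_add
      (N := fun y => L' * ‖y - u‖ + K * ‖y - u‖ ^ 2) (by
        filter_upwards [Metric.ball_mem_nhds w (sub_pos.2 hlt)] with y hy
        refine hmin' y ?_
        have := norm_sub_le_norm_sub_add_norm_sub y w u
        rw [Metric.mem_ball, dist_eq_norm] at hy
        linarith) (hasFDerivAt_norm_sub_add_sq hne L' K) hε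
    rw [norm_neg, norm_smul, Real.norm_eq_abs, abs_of_nonneg
      (add_nonneg (div_nonneg (by linarith) hpos.le) (by positivity)), add_mul,
      div_mul_cancel₀ _ hpos.ne'] at hp
    nlinarith [mul_pos hK0 hpos]
  rcases eq_or_ne x y with rfl | hxy
  · simp
  have hd : 0 < ‖x - y‖ := norm_pos_iff.2 (sub_ne_zero.2 hxy)
  refine le_of_forall_pos_le_add fun η hη => ?_
  set L' := L + η / ‖x - y‖ with hL'
  have hL'd : L' * ‖x - y‖ = L * ‖x - y‖ + η := by rw [hL']; field_simp
  have hx' : x ∈ Metric.ball b (R / 2) := Metric.ball_subset_ball (by linarith) hx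
  have hy' : y ∈ Metric.ball b (R / 2) := Metric.ball_subset_ball (by linarith) hy
  -- Subdividing the segment removes the quadratic penalty, leaving the slope `L'`.
  have hG := le_of_forall_sub_le_sq (G := fun t => - θ (x + t • (y - x)) - t * (L' * ‖x - y‖))
    (C := K * ‖x - y‖ ^ 2) fun s t hs hst ht => by
      have hseg : x + s • (y - x) ∈ Metric.ball b (R / 2) :=
        (convex_ball b _).add_smul_sub_mem hx' hy' ⟨hs, hst.trans ht⟩
      have hn : ‖x + t • (y - x) - (x + s • (y - x))‖ = (t - s) * ‖x - y‖ := by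
        rw [add_sub_add_left_eq_sub, ← sub_smul, norm_smul, Real.norm_eq_abs,
          abs_of_nonneg (by linarith), norm_sub_rev]
      have hxyd : ‖x - y‖ ≤ R / 2 := by
        have := dist_triangle_right x y b
        rw [Metric.mem_ball] at hx hy
        rw [← dist_eq_norm]; linarith
      have := step L' (by rw [hL']; linarith [div_pos hη hd]) _ hseg (x + t • (y - x))
        (by rw [hn]; nlinarith)
      rw [hn] at this
      nlinarith
  simp only [one_smul, zero_smul, add_zero, add_sub_cancel] at hG
  linarith

end Lipschitz

theorem lowerSemicontinuous_add_coe {T : Type*} [TopologicalSpace T] {φ : T → EReal}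
    (hφ : LowerSemicontinuous φ) {f : T → ℝ}
    (hf : Continuous f) : LowerSemicontinuous fun x => φ x + (f x : EReal) :=
  hφ.add' (continuous_coe_real_ereal.comp hf).lowerSemicontinuous fun _ =>
    EReal.continuousAt_add (.inr (EReal.coe_ne_bot _)) (.inr (EReal.coe_ne_top _))

/-! ### Subgradients of strongly convex functions and tilted minimization. -/

section Convexity

variable {H : Type*} [NormedAddCommGroup H] [InnerProductSpace ℝ H]

theorem regSubdiff_quadratic_growth {ψ : H → EReal} {U : Set H} {κ : ℝ} (hbot : ∀ x, ψ x ≠ ⊥)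
    (hψ : StrongConvexOnE ψ U κ) {u v x : H} (hu : u ∈ U) (hv : v ∈ regSubdiff ψ u)
    (hx : x ∈ U) :
    ψ u + ((inner ℝ v (x - u) + κ / 2 * ‖x - u‖ ^ 2 : ℝ) : EReal) ≤ ψ x := by
  rw [mem_regSubdiff_iff (hbot u)] at hv
  obtain ⟨hdom, hv⟩ := hv
  obtain ⟨α, hα⟩ := exists_coe_of_mem_dom (hbot u) hdom
  induction hβ : ψ x with
  | bot => exact absurd hβ (hbot x)
  | top => exact le_top
  | coe β =>
    rw [hα]
    norm_cast
    -- The subgradient estimate and strong convexity are combined at `u + t • (x - u)`, divided by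
    -- `t`, and `t` is sent to `0` from the right.
    have key : ∀ ε : ℝ, 0 < ε → α + inner ℝ v (x - u) - ε * ‖x - u‖ + κ / 2 * ‖x - u‖ ^ 2 ≤ β := by
      intro ε hε
      have hpath : Tendsto (fun t : ℝ => u + t • (x - u)) (𝓝[>] 0) (𝓝 u) := by
        have : Continuous fun t : ℝ => u + t • (x - u) := by fun_prop
        simpa using (this.tendsto 0).mono_left nhdsWithin_le_nhds
      have hlim : Tendsto (fun t : ℝ => α + inner ℝ v (x - u) - ε * ‖x - u‖
          + κ / 2 * (1 - t) * ‖x - u‖ ^ 2) (𝓝[>] 0)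
          (𝓝 (α + inner ℝ v (x - u) - ε * ‖x - u‖ + κ / 2 * (1 - 0) * ‖x - u‖ ^ 2)) := by
        refine Tendsto.mono_left (Continuous.tendsto ?_ 0) nhdsWithin_le_nhds
        fun_prop
      rw [sub_zero, mul_one] at hlim
      refine le_of_tendsto hlim ?_
      filter_upwards [hpath.eventually (hv ε hε), self_mem_nhdsWithin,
        nhdsWithin_le_nhds (ge_mem_nhds (one_pos (α := ℝ)))] with t ht ht0 ht1
      have ht0 : 0 < t := ht0
      have hc := hψ.2 u hu x hx t ht0.le ht1
      have hpt : (1 - t) • u + t • x = u + t • (x - u) := by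
        rw [sub_smul, one_smul, smul_sub]; abel
      rw [hpt] at hc
      have h := ht.trans hc
      rw [hα, hβ, add_sub_cancel_left, inner_smul_right, norm_smul, Real.norm_eq_abs,
        abs_of_pos ht0, norm_sub_rev u x] at h
      norm_cast at h
      have : t * (α + inner ℝ v (x - u) - ε * ‖x - u‖ + κ / 2 * (1 - t) * ‖x - u‖ ^ 2) ≤ t * β := by
        linarith
      exact le_of_mul_le_mul_left this ht0
    rcases eq_or_ne x u with rfl | hne
    · have := key 1 one_pos
      simpa using this
    have hd : 0 < ‖x - u‖ := norm_pos_iff.2 (sub_ne_zero.2 hne)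
    refine le_of_forall_pos_le_add fun η hη => ?_
    have := key (η / ‖x - u‖) (by positivity)
    rw [div_mul_cancel₀ _ hd.ne'] at this
    linarith

/-- The estimate for regular subgradients is closed under limits in which function values also
converge; since `U` is a neighborhood of `u`, the approximating points eventually lie in it. -/
theorem limSubdiff_quadratic_growth {ψ : H → EReal} {U : Set H} {κ : ℝ} (hbot : ∀ x, ψ x ≠ ⊥)
    (hψ : StrongConvexOnE ψ U κ) {u v x : H} (hu : U ∈ 𝓝 u) (hv : v ∈ limSubdiff ψ u)
    (hx : x ∈ U) :
    ψ u + ((inner ℝ v (x - u) + κ / 2 * ‖x - u‖ ^ 2 : ℝ) : EReal) ≤ ψ x := by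
  obtain ⟨-, p, q, hp, hψp, hq, hqv⟩ := hv
  have h1 : Tendsto (fun k => ((inner ℝ (q k) (x - p k) + κ / 2 * ‖x - p k‖ ^ 2 : ℝ) : EReal))
      atTop (𝓝 ((inner ℝ v (x - u) + κ / 2 * ‖x - u‖ ^ 2 : ℝ) : EReal)) :=
    EReal.tendsto_coe.2 ((hqv.inner (hp.const_sub x)).add
      (((hp.const_sub x).norm.pow 2).const_mul _))
  refine le_of_tendsto ((EReal.continuousAt_add (p := (_, _)) (.inr (EReal.coe_ne_bot _))
    (.inr (EReal.coe_ne_top _))).tendsto.comp (hψp.prodMk_nhds h1)) ?_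
  filter_upwards [hp hu] with k hk
  exact regSubdiff_quadratic_growth hbot hψ hk (hq k) hx

/-- Two subgradient inequalities with the same quadratic term yield monotonicity. -/
theorem inner_le_of_quadratic_growth {ψ : H → EReal} {c : ℝ} {u v u' v' : H}
    (hbot : ψ u ≠ ⊥) (hbot' : ψ u' ≠ ⊥) (hu : u ∈ dom ψ) (hu' : u' ∈ dom ψ)
    (h : ψ u + ((inner ℝ v (u' - u) + c / 2 * ‖u' - u‖ ^ 2 : ℝ) : EReal) ≤ ψ u')
    (h' : ψ u' + ((inner ℝ v' (u - u') + c / 2 * ‖u - u'‖ ^ 2 : ℝ) : EReal) ≤ ψ u) :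
    c * ‖u' - u‖ ^ 2 ≤ inner ℝ (v' - v) (u' - u) := by
  obtain ⟨α, hα⟩ := exists_coe_of_mem_dom hbot hu
  obtain ⟨β, hβ⟩ := exists_coe_of_mem_dom hbot' hu'
  rw [hα, hβ] at h h'
  norm_cast at h h'
  rw [norm_sub_rev u u', ← neg_sub u' u, inner_neg_right] at h'
  rw [inner_sub_left]
  linarith

theorem hasFDerivAt_sq_sub_inner (ρ : ℝ) (a v u : H) :
    HasFDerivAt (fun x => ρ / 2 * ‖x - a‖ ^ 2 - inner ℝ v (x - a))
      (innerSL ℝ (ρ • (u - a) - v)) u := by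
  have h1 := (((hasFDerivAt_id (𝕜 := ℝ) u).sub_const a).norm_sq).const_mul (ρ / 2)
  have h2 := (innerSL ℝ v).hasFDerivAt.comp u ((hasFDerivAt_id (𝕜 := ℝ) u).sub_const a)
  refine (h1.sub h2).congr_fderiv ?_
  ext y
  simp
  ring

variable [ProperSpace H]

/-- Local solvability of a tilted, proximally regularized minimization problem: if `φ` has the
subgradient `b` at `a` up to a quadratic term, then for all `v` close to `b` the function
`φ + ρ/2 ‖· - a‖² - ⟨v, ·⟩` has a minimizer over a ball around `a`, and it lies in the interior. -/
theorem exists_tilted_minimizer {φ : H → EReal} (hlsc : LowerSemicontinuous φ)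
    (hbot : ∀ x, φ x ≠ ⊥) {a b : H} (ha : a ∈ dom φ) {c ρ δ : ℝ} (hc : 0 < c) (hδ : 0 < δ)
    (hgrow : ∀ x ∈ Metric.closedBall a δ,
      φ a + ((inner ℝ b (x - a) + (c - ρ) / 2 * ‖x - a‖ ^ 2 : ℝ) : EReal) ≤ φ x)
    {v : H} (hv : 2 * ‖v - b‖ < c * δ) :
    ∃ u, c * ‖u - a‖ ≤ 2 * ‖v - b‖ ∧ u ∈ dom φ ∧ v - ρ • (u - a) ∈ regSubdiff φ u ∧
      ∀ x ∈ Metric.closedBall a δ, φ u +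
        ((inner ℝ v (x - u) + ρ / 2 * ‖u - a‖ ^ 2 - ρ / 2 * ‖x - a‖ ^ 2 : ℝ) : EReal) ≤ φ x := by
  set N : H → ℝ := fun x => ρ / 2 * ‖x - a‖ ^ 2 - inner ℝ v (x - a) with hN
  have hNc : Continuous N := by fun_prop
  have haδ : a ∈ Metric.closedBall a δ := Metric.mem_closedBall_self hδ.le
  obtain ⟨u, hu, hmin⟩ := ((lowerSemicontinuous_add_coe hlsc hNc).lowerSemicontinuousOn
    (Metric.closedBall a δ)).exists_isMinOn ⟨a, haδ⟩ (isCompact_closedBall a δ)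
  have hmin' : ∀ x ∈ Metric.closedBall a δ, φ u + (N u : EReal) ≤ φ x + (N x : EReal) :=
    fun x hx => hmin hx
  obtain ⟨α, hα⟩ := exists_coe_of_mem_dom (hbot a) ha
  have h1 := hmin' a haδ
  have hdom : u ∈ dom φ := by
    rw [hα] at h1
    change φ u < ⊤
    refine lt_top_iff_ne_top.2 fun htop => ?_
    rw [htop, EReal.top_add_coe, ← EReal.coe_add] at h1
    exact (EReal.coe_lt_top _).not_ge h1
  obtain ⟨β, hβ⟩ := exists_coe_of_mem_dom (hbot u) hdom
  have h2 := hgrow u hu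
  rw [hα, hβ] at h1 h2
  norm_cast at h1 h2
  simp only [hN, sub_self, norm_zero, inner_zero_right] at h1
  have hcs : inner ℝ (v - b) (u - a) ≤ ‖v - b‖ * ‖u - a‖ := real_inner_le_norm _ _
  rw [inner_sub_left] at hcs
  -- Minimality tested at `a`, added to the growth of `φ` at `u`, cancels the `ρ` terms and leaves
  -- `c/2 ‖u - a‖² ≤ ⟨v - b, u - a⟩`.
  have hnear : c * ‖u - a‖ ≤ 2 * ‖v - b‖ := by
    rcases (norm_nonneg (u - a)).eq_or_lt with h0 | hpos
    · rw [← h0]; simp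
    · refine le_of_mul_le_mul_right ?_ hpos
      nlinarith
  have hlt : ‖u - a‖ < δ := lt_of_mul_lt_mul_left (hnear.trans_lt hv) hc.le
  have hreal : ∀ x ∈ Metric.closedBall a δ, φ u + ((N u - N x : ℝ) : EReal) ≤ φ x := by
    intro x hx
    have h := hmin' x hx
    rw [hβ] at h ⊢
    induction hx' : φ x with
    | bot => exact absurd hx' (hbot x)
    | top => exact le_top
    | coe y =>
      rw [hx'] at h
      norm_cast at h ⊢
      linarith
  refine ⟨u, hnear, hdom, (mem_regSubdiff_iff (hbot u)).2 ⟨hdom, fun ε hε => ?_⟩, fun x hx => ?_⟩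
  · have h3 := (hasFDerivAt_iff_isLittleO.1 (hasFDerivAt_sq_sub_inner ρ a v u)).def hε
    filter_upwards [h3, Metric.ball_mem_nhds u (sub_pos.2 hlt)] with x hx1 hx2
    have hxδ : x ∈ Metric.closedBall a δ := by
      rw [mem_closedBall_iff_norm]
      rw [Metric.mem_ball, dist_eq_norm] at hx2
      have := norm_sub_le_norm_sub_add_norm_sub x u a
      linarith
    refine le_trans ?_ (hreal x hxδ)
    refine add_le_add le_rfl (EReal.coe_le_coe_iff.2 ?_)
    rw [Real.norm_eq_abs, innerSL_apply_apply] at hx1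
    have h4 := (abs_le.1 hx1).2
    rw [← neg_sub (ρ • (u - a)) v, inner_neg_left]
    simp only [hN]
    linarith
  · convert hreal x hx using 3
    simp only [hN]
    rw [← sub_sub_sub_cancel_right x u a, inner_sub_right]
    ring

end Convexity

theorem exists_closedBall_subset_interior {T : Type*} [PseudoMetricSpace T] {U : Set T} {a : T}
    (hU : U ∈ 𝓝 a) :
    ∃ δ : ℝ, 0 < δ ∧ Metric.closedBall a δ ⊆ interior U :=
  Metric.nhds_basis_closedBall.mem_iff.1 (interior_mem_nhds.2 hU)

/-! ### From variational strong convexity to the second-order condition. -/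

section VariationalConvexityNecessity

variable {H : Type*} [NormedAddCommGroup H] [InnerProductSpace ℝ H]

/-- Subgradient inequalities for `ψ` pass to `φ`, because `ψ ≤ φ` on `U` with equality at the common
graph points. Convexity makes `r = 0` sufficient. -/
theorem VarStrongConvexAt.proxRegularAt {φ : H → EReal} {a b : H} {σ : ℝ} (hσ : 0 ≤ σ)
    (h : VarStrongConvexAt φ a b σ) : ProxRegularAt φ a b := by
  obtain ⟨hlsc, hb, U, hU, V, hV, -, -, ψ, hψ, -, hψc, hψφ, ε, hε, hgph, heq⟩ := h
  obtain ⟨δ₁, hδ₁, hU₁⟩ := exists_closedBall_subset_interior hU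
  obtain ⟨δ₂, hδ₂, hV₂⟩ := exists_closedBall_subset_interior hV
  refine ⟨hlsc, hb, min ε (min δ₁ δ₂), 0, by positivity, le_rfl, ?_⟩
  intro x hx u hu v hv hvu hlt
  have hx1 := hU₁ (Metric.closedBall_subset_closedBall
    ((min_le_right _ _).trans (min_le_left _ _)) hx)
  have hu1 := hU₁ (Metric.closedBall_subset_closedBall
    ((min_le_right _ _).trans (min_le_left _ _)) hu)
  have hv1 := hV₂ (Metric.closedBall_subset_closedBall
    ((min_le_right _ _).trans (min_le_right _ _)) hv)
  have hmem : WithLp.toLp 2 (u, v) ∈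
      {p : WithLp 2 (H × H) | p.fst ∈ U ∧ p.snd ∈ V} ∩ gph (limSubdiff ψ) := by
    rw [← hgph]
    refine ⟨⟨interior_subset hu1, hlt.trans_le ?_, interior_subset hv1⟩, hvu⟩
    exact add_le_add le_rfl (EReal.coe_le_coe_iff.2 (min_le_left _ _))
  have hφψ : φ u = ψ u := heq _ hmem
  have hvψ : v ∈ limSubdiff ψ u := hmem.2
  rw [hφψ]
  refine le_trans (add_le_add le_rfl (EReal.coe_le_coe_iff.2 ?_))
    ((limSubdiff_quadratic_growth hψ.2 hψc (mem_interior_iff_mem_nhds.1 hu1) hvψ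
      (interior_subset hx1)).trans (hψφ x (interior_subset hx1)))
  have : 0 ≤ σ / 2 * ‖x - u‖ ^ 2 := by positivity
  linarith

variable [ProperSpace H]

/-- The regular coderivative of a mapping that locally contains the subdifferential of a strongly
convex function is positive definite with the modulus of strong convexity. -/
theorem le_inner_of_mem_regCoderiv_of_strongConvexOn {ψ : H → EReal} {U : Set H} {σ : ℝ}
    (hσ : 0 < σ) (hbot : ∀ x, ψ x ≠ ⊥) (hlsc : LowerSemicontinuous ψ)
    (hψ : StrongConvexOnE ψ U σ) {F : H → Set H} {x y : H} (hU : U ∈ 𝓝 x) {V : Set H}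
    (hV : V ∈ 𝓝 y) (hF : ∀ u ∈ U, ∀ v ∈ V, v ∈ limSubdiff ψ u → v ∈ F u)
    (hy : y ∈ limSubdiff ψ x) {z w : H} (hz : z ∈ regCoderiv F x y w) :
    σ * ‖w‖ ^ 2 ≤ inner ℝ z w := by
  obtain ⟨δ₁, hδ₁, hU₁⟩ := exists_closedBall_subset_interior hU
  obtain ⟨δ₂, hδ₂, hV₂⟩ := exists_closedBall_subset_interior hV
  have hgrow : ∀ u ∈ Metric.closedBall x δ₁,
      ψ x + ((inner ℝ y (u - x) + (σ - 0) / 2 * ‖u - x‖ ^ 2 : ℝ) : EReal) ≤ ψ u := by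
    intro u hu
    rw [sub_zero]
    exact limSubdiff_quadratic_growth hbot hψ hU hy (interior_subset (hU₁ hu))
  -- Squaring `‖q‖ ≤ ‖z‖` gives the claim. If it failed, moving `y` in the direction `q` would
  -- produce a contradiction.
  set q : H := z - (2 * σ) • w with hq
  have hqz : ‖q‖ ≤ ‖z‖ := by
    by_contra hlt
    rw [not_le] at hlt
    have hq0 : 0 < ‖q‖ := (norm_nonneg z).trans_lt hlt
    have hC : 0 < 2 * σ * (2 / σ + 1) := by positivity
    -- The displacement in both coordinates will total at most `(2 / σ + 1) * s`, so this `ε` limits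
    -- the coderivative error, scaled by `2σ`, to half of the gap `(‖q‖ - ‖z‖) * s`.
    set ε : ℝ := (‖q‖ - ‖z‖) / (2 * (2 * σ * (2 / σ + 1))) with hε
    have hε0 : 0 < ε := div_pos (sub_pos.2 hlt) (by positivity)
    obtain ⟨δ₃, hδ₃, h3⟩ := (mem_regCoderiv_iff.1 hz).2 ε hε0
    set s : ℝ := min (min (σ * δ₁ / 4) (σ * δ₃ / 4)) (min δ₂ (δ₃ / 2)) with hs
    have hs0 : 0 < s := by positivity
    have hs1 : s ≤ σ * δ₁ / 4 := (min_le_left _ _).trans (min_le_left _ _)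
    have hs2 : s ≤ σ * δ₃ / 4 := (min_le_left _ _).trans (min_le_right _ _)
    have hs3 : s ≤ δ₂ := (min_le_right _ _).trans (min_le_left _ _)
    have hs4 : s ≤ δ₃ / 2 := (min_le_right _ _).trans (min_le_right _ _)
    set t : ℝ := s / ‖q‖ with ht
    have ht0 : 0 < t := by positivity
    have htq : t * ‖q‖ = s := by rw [ht]; field_simp
    have hvy : ‖y + t • q - y‖ = s := by
      rw [add_sub_cancel_left, norm_smul, Real.norm_eq_abs, abs_of_pos ht0, htq]
    obtain ⟨u, hu, hudom, hvu, -⟩ := exists_tilted_minimizer hlsc hbot hy.1 hσ hδ₁ hgrow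
      (v := y + t • q) (by rw [hvy]; nlinarith)
    rw [zero_smul, sub_zero] at hvu
    rw [hvy] at hu
    have hvlim := regSubdiff_subset_limSubdiff _ _ hvu
    have hux1 : ‖u - x‖ ≤ δ₁ := le_of_mul_le_mul_left (by linarith [mul_pos hσ hδ₁]) hσ
    have hux3 : ‖u - x‖ < δ₃ := lt_of_mul_lt_mul_left (by linarith [mul_pos hσ hδ₃]) hσ.le
    have huU := hU₁ (mem_closedBall_iff_norm.2 hux1)
    have hvV := interior_subset (hV₂ (mem_closedBall_iff_norm.2 (hvy.le.trans hs3)))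
    have hcod := h3 u _ (hF u (interior_subset huU) _ hvV hvlim) hux3 (by linarith)
    have hmono := inner_le_of_quadratic_growth (c := σ) (hbot x) (hbot u) hy.1 hudom
      (limSubdiff_quadratic_growth hbot hψ hU hy (interior_subset huU))
      (limSubdiff_quadratic_growth hbot hψ (mem_interior_iff_mem_nhds.1 huU) hvlim
        (mem_of_mem_nhds hU))
    rw [hvy] at hcod
    rw [add_sub_cancel_left, inner_smul_right] at hcod
    rw [add_sub_cancel_left] at hmono
    -- Strong monotonicity makes the reflection `2σu - v` nonexpansive.
    have hr : ‖(2 * σ) • (u - x) - t • q‖ ≤ s := by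
      refine le_of_sq_le_sq ?_ hs0.le
      rw [norm_sub_sq_real, norm_smul, norm_smul, inner_smul_left,
        real_inner_comm, Real.norm_eq_abs, Real.norm_eq_abs, abs_of_pos ht0, htq,
        abs_of_pos (by positivity), mul_pow]
      simp only [conj_trivial]
      nlinarith
    have hcs : -(‖z‖ * s) ≤ inner ℝ z ((2 * σ) • (u - x) - t • q) := by
      have := abs_le.1 (abs_real_inner_le_norm z ((2 * σ) • (u - x) - t • q))
      have h5 : ‖z‖ * ‖(2 * σ) • (u - x) - t • q‖ ≤ ‖z‖ * s := by gcongr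
      linarith
    rw [inner_sub_right, inner_smul_right, inner_smul_right] at hcs
    have hqq : inner ℝ z q - 2 * σ * inner ℝ w q = ‖q‖ ^ 2 := by
      rw [← real_inner_self_eq_norm_sq]
      nth_rw 3 [hq]
      rw [inner_sub_left, inner_smul_left]
      simp
    have hux : ‖u - x‖ ≤ 2 / σ * s := by
      rw [div_mul_eq_mul_div, le_div_iff₀ hσ]; linarith
    have hbd : ε * (‖u - x‖ + s) ≤ ε * ((2 / σ + 1) * s) := by
      gcongr; linarith
    have hεC : 2 * σ * (ε * ((2 / σ + 1) * s)) = (‖q‖ - ‖z‖) / 2 * s := by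
      rw [hε]; field_simp
    have h6 : t * ‖q‖ ^ 2 = s * ‖q‖ := by rw [sq, ← mul_assoc, htq]
    nlinarith [mul_pos hs0 (sub_pos.2 hlt)]
  have h7 : ‖q‖ ^ 2 ≤ ‖z‖ ^ 2 := by gcongr
  rw [hq, norm_sub_sq_real, inner_smul_right, norm_smul, Real.norm_eq_abs,
    abs_of_pos (by positivity : 0 < 2 * σ), mul_pow] at h7
  have h8 : 4 * σ * (σ * ‖w‖ ^ 2) ≤ 4 * σ * inner ℝ z w := by linarith
  exact le_of_mul_le_mul_left h8 (by positivity)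

/-- Subdifferential continuity makes the level restriction in `U_ε` automatic near `(a, b)`, so
every nearby graph point of `∂φ` is one of `∂ψ`, and the bound for strongly convex `ψ` applies. -/
theorem VarStrongConvexAt.exists_le_inner_of_mem_combinedSubdiff2 {φ : H → EReal} {a b : H}
    {σ : ℝ} (hσ : 0 < σ) (h : VarStrongConvexAt φ a b σ) (hcont : SubdiffContinuousAt φ a b) :
    ∃ U ∈ 𝓝 a, ∃ V ∈ 𝓝 b, ∀ x ∈ U, ∀ y ∈ V, y ∈ limSubdiff φ x →
      ∀ w, ∀ z ∈ combinedSubdiff2 φ x y w, σ * ‖w‖ ^ 2 ≤ inner ℝ z w := by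
  obtain ⟨hlsc, hb, U, hU, V, hV, -, -, ψ, hψ, hψlsc, hψc, hψφ, ε, hε, hgph, heq⟩ := h
  obtain ⟨δ, hδ, hφε⟩ := hcont.2 ε hε
  refine ⟨interior U ∩ Metric.closedBall a δ,
    inter_mem (interior_mem_nhds.2 hU) (Metric.closedBall_mem_nhds a hδ),
    interior V ∩ Metric.closedBall b δ,
    inter_mem (interior_mem_nhds.2 hV) (Metric.closedBall_mem_nhds b hδ), ?_⟩
  rintro x ⟨hxU, hxδ⟩ y ⟨hyV, hyδ⟩ hyx w z hz
  have hmem : WithLp.toLp 2 (x, y) ∈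
      {p : WithLp 2 (H × H) | p.fst ∈ U ∧ p.snd ∈ V} ∩ gph (limSubdiff ψ) := by
    rw [← hgph]
    exact ⟨⟨interior_subset hxU, (hφε x hxδ y hyδ hyx).1, interior_subset hyV⟩, hyx⟩
  refine le_inner_of_mem_regCoderiv_of_strongConvexOn hσ hψ.2 hψlsc hψc
    (mem_interior_iff_mem_nhds.1 hxU) (mem_interior_iff_mem_nhds.1 hyV) (fun u hu v hv huv => ?_)
    hmem.2 hz
  have : WithLp.toLp 2 (u, v) ∈
      {p : WithLp 2 (H × H) | p.fst ∈ U ∧ p.snd ∈ V} ∩ gph (limSubdiff ψ) := ⟨⟨hu, hv⟩, huv⟩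
  rw [← hgph] at this
  exact this.2

end VariationalConvexityNecessity

/-! ### Cocoercivity of the localized inverse. -/

section Cocoercivity

variable {H : Type*} [NormedAddCommGroup H] [InnerProductSpace ℝ H]

/-- Descent lemma for a function whose subgradient selection `g` is cocoercive. -/
theorem le_add_sq_of_cocoercive {h : H → ℝ} {g : H → H} {B : Set H} (hB : Convex ℝ B) {κ : ℝ}
    (hκ : 0 < κ) (hh : ∀ v ∈ B, ∀ v' ∈ B, h v' - h v ≤ inner ℝ (g v') (v' - v))
    (hg : ∀ v ∈ B, ∀ v' ∈ B, κ * ‖g v' - g v‖ ^ 2 ≤ inner ℝ (g v' - g v) (v' - v))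
    {v v' : H} (hv : v ∈ B) (hv' : v' ∈ B) :
    h v' ≤ h v + inner ℝ (g v) (v' - v) + 1 / (2 * κ) * ‖v' - v‖ ^ 2 := by
  set d := v' - v with hd
  have hseg : ∀ t : ℝ, 0 ≤ t → t ≤ 1 → v + t • d ∈ B := fun t h0 h1 => by
    rw [hd]; exact hB.add_smul_sub_mem hv hv' ⟨h0, h1⟩
  have hlip : ∀ t : ℝ, 0 ≤ t → t ≤ 1 → inner ℝ (g (v + t • d) - g v) d ≤ t * (1 / κ * ‖d‖ ^ 2) := by
    intro t h0 h1
    rcases h0.eq_or_lt with rfl | hpos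
    · simp
    have h2 := hg v hv _ (hseg t h0 h1)
    -- Expanding this square and inserting cocoercivity gives `κt⟨Δg, d⟩ ≤ t²‖d‖²`.
    have h3 : 0 ≤ ‖κ • (g (v + t • d) - g v) - t • d‖ ^ 2 := by positivity
    rw [norm_sub_sq_real, norm_smul, norm_smul, inner_smul_left, inner_smul_right,
      Real.norm_eq_abs, Real.norm_eq_abs, mul_pow, mul_pow, sq_abs, sq_abs] at h3
    rw [add_sub_cancel_left, inner_smul_right] at h2
    simp only [conj_trivial] at h3
    have h4 : (κ * t) * inner ℝ (g (v + t • d) - g v) d ≤ (κ * t) * (t * (1 / κ * ‖d‖ ^ 2)) := by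
      have : (κ * t) * (t * (1 / κ * ‖d‖ ^ 2)) = t ^ 2 * ‖d‖ ^ 2 := by field_simp
      nlinarith
    exact le_of_mul_le_mul_left h4 (by positivity)
  -- The increments of `h` are at most the slope at the right endpoint; against the claimed
  -- quadratic bound this loses only a multiple of `(t - s) ^ 2`.
  have hG := le_of_forall_sub_le_sq
    (G := fun t => h (v + t • d) - t * inner ℝ (g v) d - t ^ 2 * (1 / (2 * κ) * ‖d‖ ^ 2))
    (C := 1 / (2 * κ) * ‖d‖ ^ 2) fun s t hs hst ht => by
      have h1 := hh _ (hseg s hs (hst.trans ht)) _ (hseg t (hs.trans hst) ht)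
      rw [add_sub_add_left_eq_sub, ← sub_smul, inner_smul_right] at h1
      have h2 := hlip t (hs.trans hst) ht
      rw [inner_sub_left] at h2
      have h3 : 1 / κ * ‖d‖ ^ 2 = 2 * (1 / (2 * κ) * ‖d‖ ^ 2) := by field_simp
      rw [h3] at h2
      nlinarith [mul_le_mul_of_nonneg_left h2 (sub_nonneg.2 hst)]
  simp only [one_smul, zero_smul, add_zero] at hG
  rw [hd, add_sub_cancel, ← hd] at hG
  linarith

variable [ProperSpace H]

/-- If the regular coderivative of `F` is positive definite with modulus `σ`, then the Lipschitz
localization `g` of the inverse of `F + ρ (· - a)` is cocoercive with modulus `σ + ρ`. -/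
theorem cocoercive_of_le_inner_regCoderiv {F : H → Set H} {g : H → H} {a b : H} {R σ ρ δ : ℝ}
    (hR : 0 < R) (hρ : 0 ≤ ρ) (hκ : 0 < σ + ρ)
    (hlip : ∀ v ∈ Metric.ball b R, ∀ v' ∈ Metric.ball b R, ‖g v - g v'‖ ≤ ‖v - v'‖)
    (hmem : ∀ v ∈ Metric.ball b R, v - ρ • (g v - a) ∈ F (g v))
    (hga : ∀ v ∈ Metric.ball b R, ‖g v - a‖ < δ ∧ ‖v - ρ • (g v - a) - b‖ < δ)
    (huniq : ∀ u ∈ Metric.closedBall a δ, ∀ y ∈ Metric.closedBall b δ, y ∈ F u →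
      y + ρ • (u - a) ∈ Metric.ball b R → g (y + ρ • (u - a)) = u)
    (hcod : ∀ x ∈ Metric.closedBall a δ, ∀ y ∈ Metric.closedBall b δ, y ∈ F x →
      ∀ w, ∀ z ∈ regCoderiv F x y w, σ * ‖w‖ ^ 2 ≤ inner ℝ z w)
    {v v' : H} (hv : v ∈ Metric.ball b (R / 4)) (hv' : v' ∈ Metric.ball b (R / 4)) :
    (σ + ρ) * ‖g v' - g v‖ ^ 2 ≤ inner ℝ (g v' - g v) (v' - v) := by
  set κ := σ + ρ with hκdef
  set T : H → H := fun v => (2 * κ) • g v - v with hT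
  have hTsub : ∀ u u', T u - T u' = (2 * κ) • (g u - g u') - (u - u') := fun u u' => by
    simp only [hT, smul_sub]; abel
  have hTlip : ∀ z u u', u ∈ Metric.ball b R → u' ∈ Metric.ball b R →
      inner ℝ z (T u) - inner ℝ z (T u') ≤ ‖z‖ * (2 * κ + 1) * ‖u - u'‖ := by
    intro z u u' hu hu'
    rw [← inner_sub_right, hTsub, mul_assoc]
    refine (real_inner_le_norm _ _).trans ?_
    gcongr
    refine (norm_sub_le _ _).trans ?_
    rw [norm_smul, Real.norm_eq_abs, abs_of_pos (by positivity)]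
    have := mul_le_mul_of_nonneg_left (hlip u hu u' hu') (by positivity : 0 ≤ 2 * κ)
    linarith
  have hsub : ∀ z, ∀ x ∈ Metric.ball b R, ∀ p : H,
      (∀ ε : ℝ, 0 < ε → ∀ᶠ y in 𝓝 x,
        inner ℝ z (T x) + inner ℝ p (y - x) - ε * ‖y - x‖ ≤ inner ℝ z (T y)) → ‖p‖ ≤ ‖z‖ := by
    intro z x hx p hp
    obtain ⟨hx1, hx2⟩ := hga x hx
    -- The substitution `x' = y + ρ • (u - a)` identifies nearby graph points `(u, y)` of `F` with
    -- `u = g x'`. Rewriting the subgradient inequality for `⟨z, T ·⟩` in these coordinates gives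
    -- this coderivative element.
    have hcd : -(2 * κ) • z + ρ • (p + z) ∈
        regCoderiv F (g x) (x - ρ • (g x - a)) (-(p + z)) := by
      refine mem_regCoderiv_iff.2 ⟨hmem x hx, fun ε hε => ?_⟩
      obtain ⟨η, hη, hη1⟩ := Metric.eventually_nhds_iff.1
        ((hp (ε / (1 + ρ)) (by positivity)).and (Metric.isOpen_ball.mem_nhds hx))
      refine ⟨min (min (δ - ‖g x - a‖) (δ - ‖x - ρ • (g x - a) - b‖)) (η / (1 + ρ)), ?_, ?_⟩
      · have := sub_pos.2 hx1
        have := sub_pos.2 hx2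
        positivity
      intro u y hyu hu hy
      have hu1 := hu.trans_le ((min_le_left _ _).trans (min_le_left _ _))
      have hu2 := hu.trans_le (min_le_right _ _)
      have hy1 := hy.trans_le ((min_le_left _ _).trans (min_le_right _ _))
      have hy2 := hy.trans_le (min_le_right _ _)
      set x' := y + ρ • (u - a) with hx'
      have hΔ : x' - x = (y - (x - ρ • (g x - a))) + ρ • (u - g x) := by
        rw [hx']; simp only [smul_sub]; abel
      have hnΔ : ‖x' - x‖ ≤ ‖y - (x - ρ • (g x - a))‖ + ρ * ‖u - g x‖ := by
        rw [hΔ]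
        refine (norm_add_le _ _).trans ?_
        rw [norm_smul, Real.norm_eq_abs, abs_of_nonneg hρ]
      have hdist : dist x' x < η := by
        rw [dist_eq_norm]
        have h1 : ρ * ‖u - g x‖ ≤ ρ * (η / (1 + ρ)) := by gcongr
        have h2 : η / (1 + ρ) + ρ * (η / (1 + ρ)) = η := by field_simp
        linarith
      obtain ⟨h3, h4⟩ := hη1 hdist
      have hgu : g x' = u := by
        refine huniq u ?_ y ?_ hyu h4
        · rw [mem_closedBall_iff_norm]
          have := norm_sub_le_norm_sub_add_norm_sub u (g x) a
          linarith
        · rw [mem_closedBall_iff_norm]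
          have := norm_sub_le_norm_sub_add_norm_sub y (x - ρ • (g x - a)) b
          linarith
      have h5 : inner ℝ p (x' - x) - inner ℝ z (T x' - T x) ≤ ε / (1 + ρ) * ‖x' - x‖ := by
        rw [inner_sub_right z]; linarith
      have hyx : y - (x - ρ • (g x - a)) = (x' - x) - ρ • (u - g x) := by rw [hΔ]; abel
      calc _ = inner ℝ p (x' - x) - inner ℝ z (T x' - T x) := by
            rw [hyx, hTsub, hgu]
            simp only [inner_add_left, inner_sub_right, inner_smul_left, inner_smul_right,
              inner_neg_left, conj_trivial]
            ring
        _ ≤ ε / (1 + ρ) * ‖x' - x‖ := h5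
        _ ≤ ε / (1 + ρ) * ((1 + ρ) * (‖u - g x‖ + ‖y - (x - ρ • (g x - a))‖)) := by
            gcongr
            nlinarith [norm_nonneg (u - g x),
              mul_nonneg hρ (norm_nonneg (y - (x - ρ • (g x - a))))]
        _ = _ := by field_simp
    have h6 := hcod (g x) (mem_closedBall_iff_norm.2 hx1.le) _ (mem_closedBall_iff_norm.2 hx2.le)
      (hmem x hx) _ _ hcd
    rw [norm_neg, inner_neg_right, inner_add_left, inner_smul_left, inner_smul_left,
      real_inner_self_eq_norm_sq] at h6
    simp only [conj_trivial] at h6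
    -- The second-order inequality reads `‖p + z‖² ≤ 2⟨z, p + z⟩` after division by `κ`, that is,
    -- `‖p‖ ≤ ‖z‖`.
    have h7 : κ * ‖p + z‖ ^ 2 ≤ κ * (2 * inner ℝ z (p + z)) := by rw [hκdef] at *; linarith
    have h8 := le_of_mul_le_mul_left h7 hκ
    rw [inner_add_right, real_inner_self_eq_norm_sq, norm_add_sq_real, real_inner_comm] at h8
    refine le_of_sq_le_sq ?_ (norm_nonneg z)
    linarith
  have hne : ‖T v' - T v‖ ≤ ‖v' - v‖ := by
    -- Scalarizing along `T v' - T v` itself turns the scalar Lipschitz bound into the vector one.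
    -- The crude constant `2κ + 1` serves only as an a priori Lipschitz bound.
    have := sub_le_of_regular_subgradients_bounded (θ := fun u => inner ℝ (T v' - T v) (T u)) hR
      (norm_nonneg _) (by positivity : 0 ≤ ‖T v' - T v‖ * (2 * κ + 1))
      (fun x hx y hy => hTlip _ x y hx hy) (hsub _) hv' hv
    rw [← inner_sub_right, real_inner_self_eq_norm_sq] at this
    rcases (norm_nonneg (T v' - T v)).eq_or_lt with h0 | hpos
    · rw [← h0]; positivity
    · rw [sq] at this
      exact le_of_mul_le_mul_left this hpos
  have hsq : ‖T v' - T v‖ ^ 2 ≤ ‖v' - v‖ ^ 2 := by gcongr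
  rw [hTsub, norm_sub_sq_real, inner_smul_left, norm_smul, Real.norm_eq_abs,
    abs_of_pos (by positivity), mul_pow] at hsq
  simp only [conj_trivial] at hsq
  have : 4 * κ * (κ * ‖g v' - g v‖ ^ 2) ≤ 4 * κ * inner ℝ (g v' - g v) (v' - v) := by linarith
  exact le_of_mul_le_mul_left this (by positivity)

end Cocoercivity

/-! ### From the second-order condition to quadratic growth. -/

section VariationalConvexitySufficiency

variable {H : Type*} [NormedAddCommGroup H] [InnerProductSpace ℝ H]

theorem ProxRegularAt.exists_growth {φ : H → EReal} {a b : H} (h : ProxRegularAt φ a b)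
    (hcont : SubdiffContinuousAt φ a b) :
    ∃ δ r : ℝ, 0 < δ ∧ 0 ≤ r ∧ ∀ x ∈ Metric.closedBall a δ, ∀ u ∈ Metric.closedBall a δ,
      ∀ v ∈ Metric.closedBall b δ, v ∈ limSubdiff φ u →
        φ u + ((inner ℝ v (x - u) - r / 2 * ‖x - u‖ ^ 2 : ℝ) : EReal) ≤ φ x := by
  obtain ⟨-, -, ε, r, hε, hr, hprox⟩ := h
  obtain ⟨δ, hδ, hφε⟩ := hcont.2 ε hε
  refine ⟨min ε δ, r, by positivity, hr, fun x hx u hu v hv hvu => ?_⟩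
  have h1 : ∀ c : H, Metric.closedBall c (min ε δ) ⊆ Metric.closedBall c ε := fun c =>
    Metric.closedBall_subset_closedBall (min_le_left _ _)
  have h2 : ∀ c : H, Metric.closedBall c (min ε δ) ⊆ Metric.closedBall c δ := fun c =>
    Metric.closedBall_subset_closedBall (min_le_right _ _)
  exact hprox x (h1 a hx) u (h1 a hu) v (h1 b hv) hvu (hφε u (h2 a hu) v (h2 b hv) hvu).1

variable [ProperSpace H]

/-- Positive definiteness of the combined second-order subdifferential upgrades the proximal
subgradient inequality to uniform quadratic growth. -/
theorem exists_quadratic_growth_of_le_inner {φ : H → EReal} (hlsc : LowerSemicontinuous φ)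
    (hbot : ∀ x, φ x ≠ ⊥) {a b : H} {σ r δ : ℝ} (hσ : 0 < σ) (hr : 0 ≤ r) (hδ : 0 < δ)
    (hb : b ∈ limSubdiff φ a)
    (hprox : ∀ x ∈ Metric.closedBall a δ, ∀ u ∈ Metric.closedBall a δ,
      ∀ v ∈ Metric.closedBall b δ, v ∈ limSubdiff φ u →
        φ u + ((inner ℝ v (x - u) - r / 2 * ‖x - u‖ ^ 2 : ℝ) : EReal) ≤ φ x)
    (hcod : ∀ x ∈ Metric.closedBall a δ, ∀ y ∈ Metric.closedBall b δ, y ∈ limSubdiff φ x →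
      ∀ w, ∀ z ∈ combinedSubdiff2 φ x y w, σ * ‖w‖ ^ 2 ≤ inner ℝ z w) :
    ∃ η : ℝ, 0 < η ∧ η ≤ δ ∧ ∀ x ∈ Metric.closedBall a η, ∀ u ∈ Metric.closedBall a η,
      ∀ y ∈ Metric.closedBall b η, y ∈ limSubdiff φ u →
        φ u + ((inner ℝ y (x - u) + σ / 2 * ‖x - u‖ ^ 2 : ℝ) : EReal) ≤ φ x := by
  -- The subdifferential is locally hypomonotone with constant `r`; adding `ρ(· - a)` makes it
  -- strongly monotone with modulus 1, so its inverse is 1-Lipschitz.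
  set ρ : ℝ := r + 1 with hρ
  have hρ0 : 0 ≤ ρ := by positivity
  have haδ : a ∈ Metric.closedBall a δ := Metric.mem_closedBall_self hδ.le
  have hbδ : b ∈ Metric.closedBall b δ := Metric.mem_closedBall_self hδ.le
  have hex : ∀ v : H, ∃ u, v ∈ Metric.ball b (δ / 2) →
      1 * ‖u - a‖ ≤ 2 * ‖v - b‖ ∧ u ∈ dom φ ∧ v - ρ • (u - a) ∈ regSubdiff φ u ∧
      ∀ x ∈ Metric.closedBall a δ, φ u +
        ((inner ℝ v (x - u) + ρ / 2 * ‖u - a‖ ^ 2 - ρ / 2 * ‖x - a‖ ^ 2 : ℝ) : EReal) ≤ φ x := by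
    intro v
    by_cases hv : v ∈ Metric.ball b (δ / 2)
    · rw [Metric.mem_ball, dist_eq_norm] at hv
      obtain ⟨u, hu⟩ := exists_tilted_minimizer hlsc hbot hb.1 (b := b) (c := 1) (ρ := ρ) one_pos hδ
        (fun x hx => by
          convert hprox x hx a haδ b hbδ hb using 3
          rw [hρ]; ring) (v := v) (by linarith)
      exact ⟨u, fun _ => hu⟩
    · exact ⟨a, fun h => absurd h hv⟩
  choose g hg using hex
  -- Since `‖g v - a‖ ≤ 2‖v - b‖`, this radius keeps both `g v` and `v - ρ • (g v - a)` in the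
  -- `δ`-balls.
  set R : ℝ := δ / (2 * (1 + 2 * ρ)) with hR
  have hR0 : 0 < R := by positivity
  have hRδ : (1 + 2 * ρ) * R = δ / 2 := by rw [hR]; field_simp
  have hR2 : R ≤ δ / 2 := by rw [← hRδ]; nlinarith
  have hgR : ∀ v ∈ Metric.ball b R, ‖g v - a‖ < δ ∧ ‖v - ρ • (g v - a) - b‖ < δ := by
    intro v hv
    obtain ⟨h1, -⟩ := hg v (Metric.ball_subset_ball hR2 hv)
    rw [Metric.mem_ball, dist_eq_norm] at hv
    refine ⟨by linarith, ?_⟩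
    rw [sub_right_comm]
    refine (norm_sub_le _ _).trans_lt ?_
    rw [norm_smul, Real.norm_eq_abs, abs_of_nonneg hρ0]
    have : ρ * ‖g v - a‖ ≤ ρ * (2 * ‖v - b‖) := by gcongr; linarith
    nlinarith
  have hgmem : ∀ v ∈ Metric.ball b R, v - ρ • (g v - a) ∈ limSubdiff φ (g v) := fun v hv =>
    regSubdiff_subset_limSubdiff _ _ (hg v (Metric.ball_subset_ball hR2 hv)).2.2.1
  have hmono : ∀ u ∈ Metric.closedBall a δ, ∀ v ∈ Metric.closedBall b δ, v ∈ limSubdiff φ u →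
      ∀ u' ∈ Metric.closedBall a δ, ∀ v' ∈ Metric.closedBall b δ, v' ∈ limSubdiff φ u' →
      -r * ‖u' - u‖ ^ 2 ≤ inner ℝ (v' - v) (u' - u) := by
    intro u hu v hv hvu u' hu' v' hv' hvu'
    refine inner_le_of_quadratic_growth (hbot u) (hbot u') hvu.1 hvu'.1 ?_ ?_
    · convert hprox u' hu' u hu v hv hvu using 3; ring
    · convert hprox u hu u' hu' v' hv' hvu' using 3; ring
  have hreg : ∀ u ∈ Metric.closedBall a δ, ∀ v ∈ Metric.closedBall b δ, v ∈ limSubdiff φ u →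
      ∀ u' ∈ Metric.closedBall a δ, ∀ v' ∈ Metric.closedBall b δ, v' ∈ limSubdiff φ u' →
      ‖u' - u‖ ≤ ‖(v' + ρ • (u' - a)) - (v + ρ • (u - a))‖ := by
    intro u hu v hv hvu u' hu' v' hv' hvu'
    have h1 := hmono u hu v hv hvu u' hu' v' hv' hvu'
    have h2 : (v' + ρ • (u' - a)) - (v + ρ • (u - a)) = (v' - v) + ρ • (u' - u) := by
      simp only [smul_sub]; abel
    have h3 := real_inner_le_norm ((v' - v) + ρ • (u' - u)) (u' - u)
    rw [inner_add_left, inner_smul_left, real_inner_self_eq_norm_sq] at h3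
    simp only [conj_trivial] at h3
    rw [h2]
    rcases (norm_nonneg (u' - u)).eq_or_lt with h0 | hpos
    · rw [← h0]; positivity
    · refine le_of_mul_le_mul_right ?_ hpos
      rw [hρ] at h3 ⊢
      nlinarith
  have hlip : ∀ v ∈ Metric.ball b R, ∀ v' ∈ Metric.ball b R, ‖g v - g v'‖ ≤ ‖v - v'‖ := by
    intro v hv v' hv'
    have := hreg _ (mem_closedBall_iff_norm.2 (hgR v' hv').1.le) _
      (mem_closedBall_iff_norm.2 (hgR v' hv').2.le) (hgmem v' hv')
      _ (mem_closedBall_iff_norm.2 (hgR v hv).1.le) _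
      (mem_closedBall_iff_norm.2 (hgR v hv).2.le) (hgmem v hv)
    rwa [sub_add_cancel, sub_add_cancel] at this
  have huniq : ∀ u ∈ Metric.closedBall a δ, ∀ y ∈ Metric.closedBall b δ, y ∈ limSubdiff φ u →
      y + ρ • (u - a) ∈ Metric.ball b R → g (y + ρ • (u - a)) = u := by
    intro u hu y hy hyu hv
    have := hreg u hu y hy hyu _ (mem_closedBall_iff_norm.2 (hgR _ hv).1.le) _
      (mem_closedBall_iff_norm.2 (hgR _ hv).2.le) (hgmem _ hv)
    rw [sub_add_cancel, sub_self, norm_zero] at this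
    exact sub_eq_zero.1 (norm_eq_zero.1 (le_antisymm this (norm_nonneg _)))
  have hκ : 0 < σ + ρ := by positivity
  have hcoc := fun v hv v' hv' => cocoercive_of_le_inner_regCoderiv (v := v) (v' := v')
    hR0 hρ0 hκ hlip hgmem hgR huniq hcod hv hv'
  set κ := σ + ρ with hκdef
  have hball : Metric.ball b (R / 4) ⊆ Metric.ball b (δ / 2) :=
    Metric.ball_subset_ball (by linarith)
  set f : H → ℝ := fun u => (φ u).toReal + ρ / 2 * ‖u - a‖ ^ 2 with hf
  have hfφ : ∀ u ∈ dom φ, φ u = ((f u - ρ / 2 * ‖u - a‖ ^ 2 : ℝ) : EReal) := by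
    intro u hu
    simp only [hf, add_sub_cancel_right]
    exact (EReal.coe_toReal (ne_of_lt hu) (hbot u)).symm
  have hfmin : ∀ v ∈ Metric.ball b (R / 4), ∀ x ∈ Metric.closedBall a δ, x ∈ dom φ →
      f (g v) + inner ℝ v (x - g v) ≤ f x := by
    intro v hv x hx hxd
    obtain ⟨-, hd, -, h1⟩ := hg v (hball hv)
    have h2 := h1 x hx
    rw [hfφ _ hd, hfφ x hxd] at h2
    norm_cast at h2
    linarith
  have hgδ : ∀ v ∈ Metric.ball b (R / 4), g v ∈ Metric.closedBall a δ := fun v hv =>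
    mem_closedBall_iff_norm.2 (hgR v (Metric.ball_subset_ball (by linarith) hv)).1.le
  -- The function `⟨v, g v⟩ - f (g v)` is the local Fenchel conjugate of `f`, with `g` as its
  -- subgradient selection.
  have hdesc := fun v hv v' hv' => le_add_sq_of_cocoercive (v := v) (v' := v')
    (h := fun v => inner ℝ v (g v) - f (g v)) (convex_ball b (R / 4)) hκ
    (fun v hv v' hv' => by
      have := hfmin v hv (g v') (hgδ v' hv') (hg v' (hball hv')).2.1
      rw [inner_sub_right] at this
      rw [inner_sub_right, real_inner_comm v', real_inner_comm v]
      linarith) hcoc hv hv'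
  refine ⟨R / (8 * (1 + κ)), by positivity, ?_, ?_⟩
  · rw [div_le_iff₀ (by positivity)]; nlinarith
  -- Small enough that both `v` and the shifted dual point `v + κ • (x - u)` stay in the ball of
  -- radius `R / 4`.
  set η := R / (8 * (1 + κ)) with hη
  have hη0 : 0 < η := by positivity
  have hηR : (1 + κ) * η = R / 8 := by rw [hη]; field_simp
  have hηδ : η ≤ δ := by nlinarith
  intro x hx u hu y hy hyu
  have hxδ := Metric.closedBall_subset_closedBall hηδ hx
  have huδ := Metric.closedBall_subset_closedBall hηδ hu
  have hyδ := Metric.closedBall_subset_closedBall hηδ hy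
  rw [mem_closedBall_iff_norm] at hx hu hy
  set v := y + ρ • (u - a) with hv
  have hvb : v ∈ Metric.ball b (R / 4) := by
    rw [Metric.mem_ball, dist_eq_norm, hv, add_sub_right_comm]
    refine (norm_add_le _ _).trans_lt ?_
    rw [norm_smul, Real.norm_eq_abs, abs_of_nonneg hρ0]
    have : ρ * ‖u - a‖ ≤ ρ * η := by gcongr
    nlinarith
  have hvb' : v + κ • (x - u) ∈ Metric.ball b (R / 4) := by
    have hdec : v + κ • (x - u) - b = (y - b) + κ • (x - a) - σ • (u - a) := by
      rw [hv, hκdef]; simp only [smul_sub, add_smul]; abel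
    rw [Metric.mem_ball, dist_eq_norm, hdec]
    refine (norm_sub_le _ _).trans_lt ((add_le_add (norm_add_le _ _) le_rfl).trans_lt ?_)
    rw [norm_smul, norm_smul, Real.norm_eq_abs, Real.norm_eq_abs, abs_of_pos hκ, abs_of_pos hσ]
    have h1 : κ * ‖x - a‖ ≤ κ * η := by gcongr
    have h2 : σ * ‖u - a‖ ≤ σ * η := by gcongr
    have h3 : 0 ≤ ρ * η := by positivity
    have h4 : κ * η = σ * η + ρ * η := by rw [hκdef]; ring
    nlinarith
  have hgv : g v = u := huniq u huδ y hyδ hyu (Metric.ball_subset_ball (by linarith) hvb)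
  have h1 := hdesc v hvb _ hvb'
  induction hφx : φ x with
  | bot => exact absurd hφx (hbot x)
  | top => exact le_top
  | coe α =>
    have hxd : x ∈ dom φ := by
      change φ x < ⊤
      rw [hφx]; exact EReal.coe_lt_top _
    -- The Fenchel–Young inequality at `v + κ • (x - u)`, the dual point that is optimal for the
    -- descent bound, gives `f` growth with modulus `κ` at `u`.
    have h2 := hfmin _ hvb' x hxδ hxd
    rw [← hφx, hfφ u hyu.1, hfφ x hxd]
    norm_cast
    simp only [hgv, add_sub_cancel_left] at h1
    rw [inner_smul_right, norm_smul, Real.norm_eq_abs, abs_of_pos hκ] at h1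
    rw [inner_sub_right, inner_add_left (v : H) (κ • (x - u)) x, inner_smul_left] at h2
    simp only [conj_trivial] at h2
    have h3 : 1 / (2 * κ) * (κ * ‖x - u‖) ^ 2 = κ / 2 * ‖x - u‖ ^ 2 := by field_simp
    rw [h3] at h1
    have h4 : κ * inner ℝ (x - u) x - κ * inner ℝ u (x - u) = κ * ‖x - u‖ ^ 2 := by
      rw [real_inner_comm (x - u) u, ← mul_sub, ← inner_sub_right, real_inner_self_eq_norm_sq]
    have h5 : inner ℝ v x - inner ℝ v u = inner ℝ y (x - u) + ρ * inner ℝ (u - a) (x - u) := by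
      rw [← inner_sub_right, hv, inner_add_left, inner_smul_left]; simp
    have h6 : ‖x - a‖ ^ 2 = ‖x - u‖ ^ 2 + 2 * inner ℝ (u - a) (x - u) + ‖u - a‖ ^ 2 := by
      rw [← sub_add_sub_cancel x u a, norm_add_sq_real, real_inner_comm (u - a)]
    rw [h6]
    have h7 : κ * ‖x - u‖ ^ 2 = σ * ‖x - u‖ ^ 2 + ρ * ‖x - u‖ ^ 2 := by rw [hκdef]; ring
    linarith

end VariationalConvexitySufficiency

/-! ### Construction of the strongly convex minorant. -/

section Envelope

variable {H : Type*} [NormedAddCommGroup H] [InnerProductSpace ℝ H]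

/-- The supremum of the quadratic minorants `x ↦ φ u + ⟨v, x - u⟩ + σ/2 ‖x - u‖²` of `φ` generated
by a set `W` of pairs `(u, v)`. -/
noncomputable def quadraticEnvelope (φ : H → EReal) (W : Set (H × H)) (σ : ℝ) (x : H) : EReal :=
  ⨆ p : W, (((φ p.1.1).toReal + inner ℝ p.1.2 (x - p.1.1) + σ / 2 * ‖x - p.1.1‖ ^ 2 : ℝ) : EReal)

theorem le_quadraticEnvelope {φ : H → EReal} {W : Set (H × H)} {σ : ℝ} {u v : H}
    (huv : (u, v) ∈ W) (x : H) :
    (((φ u).toReal + inner ℝ v (x - u) + σ / 2 * ‖x - u‖ ^ 2 : ℝ) : EReal) ≤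
      quadraticEnvelope φ W σ x :=
  le_iSup (fun p : W => (((φ p.1.1).toReal + inner ℝ p.1.2 (x - p.1.1)
    + σ / 2 * ‖x - p.1.1‖ ^ 2 : ℝ) : EReal)) ⟨(u, v), huv⟩

theorem lowerSemicontinuous_quadraticEnvelope (φ : H → EReal) (W : Set (H × H)) (σ : ℝ) :
    LowerSemicontinuous (quadraticEnvelope φ W σ) :=
  lowerSemicontinuous_iSup fun p =>
    (continuous_coe_real_ereal.comp (by fun_prop)).lowerSemicontinuous

theorem quadraticEnvelope_ne_bot (φ : H → EReal) {W : Set (H × H)} (hW : W.Nonempty) (σ : ℝ)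
    (x : H) : quadraticEnvelope φ W σ x ≠ ⊥ := by
  obtain ⟨⟨u, v⟩, huv⟩ := hW
  exact ((EReal.bot_lt_coe _).trans_le (le_quadraticEnvelope huv x)).ne'

/-- Each generating quadratic satisfies the strong convexity inequality with equality, and suprema
preserve it. -/
theorem strongConvexOnE_quadraticEnvelope (φ : H → EReal) (W : Set (H × H)) (σ : ℝ) {U : Set H}
    (hU : Convex ℝ U) : StrongConvexOnE (quadraticEnvelope φ W σ) U σ := by
  refine ⟨hU, fun x _ y _ t ht0 ht1 => iSup_le fun ⟨⟨u, v⟩, huv⟩ => ?_⟩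
  have hx := le_quadraticEnvelope (φ := φ) (σ := σ) huv x
  have hy := le_quadraticEnvelope (φ := φ) (σ := σ) huv y
  have h1 : (0 : EReal) ≤ ((1 - t : ℝ) : EReal) := by exact_mod_cast sub_nonneg.2 ht1
  have h2 : (0 : EReal) ≤ (t : EReal) := by exact_mod_cast ht0
  refine le_trans (le_of_eq ?_) (EReal.sub_le_sub (add_le_add (mul_le_mul_of_nonneg_left hx h1)
    (mul_le_mul_of_nonneg_left hy h2)) le_rfl)
  norm_cast
  have hpt : (1 - t) • x + t • y - u = (1 - t) • (x - u) + t • (y - u) := by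
    simp only [sub_smul, smul_sub, one_smul]; abel
  rw [hpt, ← sub_sub_sub_cancel_right x y u, norm_add_sq_real, norm_sub_sq_real (x - u) (y - u),
    norm_smul, norm_smul, inner_add_right]
  simp only [inner_smul_left, inner_smul_right, mul_pow, Real.norm_eq_abs, sq_abs, conj_trivial]
  ring

variable [ProperSpace H]

/-- Uniform quadratic growth of `φ` along the graph of its subdifferential near `(a, b)` implies
variational strong convexity. -/
theorem varStrongConvexAt_of_quadratic_growth {φ : H → EReal} (hlsc : LowerSemicontinuous φ)
    (hbot : ∀ x, φ x ≠ ⊥) {a b : H} {σ ε η : ℝ} (hσ : 0 < σ) (hε : 0 < ε) (hη : 0 < η)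
    (hb : b ∈ limSubdiff φ a)
    (hlt : ∀ x ∈ Metric.closedBall a η, ∀ v ∈ Metric.closedBall b η, v ∈ limSubdiff φ x →
      φ x < φ a + (ε : EReal))
    (hgrow : ∀ x ∈ Metric.closedBall a η, ∀ u ∈ Metric.closedBall a η,
      ∀ y ∈ Metric.closedBall b η, y ∈ limSubdiff φ u →
        φ u + ((inner ℝ y (x - u) + σ / 2 * ‖x - u‖ ^ 2 : ℝ) : EReal) ≤ φ x) :
    VarStrongConvexAt φ a b σ := by
  have haη : a ∈ Metric.closedBall a η := Metric.mem_closedBall_self hη.le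
  have hbη : b ∈ Metric.closedBall b η := Metric.mem_closedBall_self hη.le
  set W : Set (H × H) := {p | p.1 ∈ Metric.closedBall a η ∧ p.2 ∈ Metric.closedBall b η ∧
    p.2 ∈ limSubdiff φ p.1} with hWdef
  set ψ := quadraticEnvelope φ W σ with hψ
  have habW : (a, b) ∈ W := ⟨haη, hbη, hb⟩
  have hcoe : ∀ u ∈ dom φ, ((φ u).toReal : EReal) = φ u := fun u hu =>
    EReal.coe_toReal (ne_of_lt hu) (hbot u)
  have hle : ∀ x ∈ Metric.closedBall a η, ψ x ≤ φ x := by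
    refine fun x hx => iSup_le fun ⟨⟨u, v⟩, hu, hv, huv⟩ => ?_
    rw [add_assoc, EReal.coe_add, hcoe u huv.1]
    exact hgrow x hx u hu v hv huv
  have hge : ∀ u v, (u, v) ∈ W → ∀ x,
      φ u + ((inner ℝ v (x - u) + σ / 2 * ‖x - u‖ ^ 2 : ℝ) : EReal) ≤ ψ x := by
    intro u v huv x
    rw [← hcoe u huv.2.2.1, ← EReal.coe_add, ← add_assoc]
    exact le_quadraticEnvelope huv x
  have heq : ∀ u v, (u, v) ∈ W → φ u = ψ u := fun u v huv =>
    le_antisymm (by simpa using hge u v huv u) (hle u huv.1)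
  have hψbot := quadraticEnvelope_ne_bot φ ⟨_, habW⟩ σ
  have hsub : ∀ u v, (u, v) ∈ W → v ∈ limSubdiff ψ u := by
    intro u v huv
    refine regSubdiff_subset_limSubdiff _ _ ((mem_regSubdiff_iff (hψbot u)).2
      ⟨(hle u huv.1).trans_lt huv.2.2.1, fun ε' hε' => .of_forall fun x => ?_⟩)
    refine le_trans ?_ (hge u v huv x)
    rw [← hψ, ← heq u v huv]
    refine add_le_add le_rfl (EReal.coe_le_coe_iff.2 ?_)
    have h1 : 0 ≤ ε' * ‖x - u‖ := by positivity
    have h2 : 0 ≤ σ / 2 * ‖x - u‖ ^ 2 := by positivity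
    linarith
  have hconv : StrongConvexOnE ψ (Metric.ball a η) σ :=
    strongConvexOnE_quadraticEnvelope φ W σ (convex_ball a η)
  -- The bound `σ * η / 2` puts the tilted minimizer inside the open `η`-ball.
  set ζ := min η (σ * η / 2) with hζ
  have hζ0 : 0 < ζ := by positivity
  have hUs : ∀ {x}, x ∈ Metric.ball a η → x ∈ Metric.closedBall a η := fun h =>
    Metric.ball_subset_closedBall h
  have hVs : ∀ {v}, v ∈ Metric.ball b ζ → v ∈ Metric.closedBall b η := fun h =>
    Metric.closedBall_subset_closedBall (min_le_left _ _) (Metric.ball_subset_closedBall h)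
  -- Maximality of the graph: tilting `φ` by `v` produces some `u` with `(u, v) ∈ W`, hence `v ∈
  -- ∂ψ(u)` too, and strong monotonicity of `∂ψ` forces `u = x`.
  have hmax : ∀ x v, x ∈ Metric.ball a η → v ∈ Metric.ball b ζ → v ∈ limSubdiff ψ x →
      (x, v) ∈ W := by
    intro x v hx hv hvx
    have hvb : ‖v - b‖ < σ * η / 2 := by
      rw [Metric.mem_ball, dist_eq_norm] at hv
      exact hv.trans_le (min_le_right _ _)
    obtain ⟨u, hu, -, hvu, -⟩ := exists_tilted_minimizer hlsc hbot hb.1 hσ hη (b := b) (ρ := 0)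
      (fun x hx => by rw [sub_zero]; exact hgrow x hx a haη b hbη hb) (v := v) (by linarith)
    rw [zero_smul, sub_zero] at hvu
    have huη : u ∈ Metric.ball a η := by
      rw [Metric.mem_ball, dist_eq_norm]
      exact lt_of_mul_lt_mul_left (by linarith) hσ.le
    have huW : (u, v) ∈ W := ⟨hUs huη, hVs hv, regSubdiff_subset_limSubdiff _ _ hvu⟩
    have hvu' := hsub u v huW
    have hmono := inner_le_of_quadratic_growth (hψbot x) (hψbot u) hvx.1 hvu'.1
      (limSubdiff_quadratic_growth hψbot hconv (Metric.isOpen_ball.mem_nhds hx) hvx huη)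
      (limSubdiff_quadratic_growth hψbot hconv (Metric.isOpen_ball.mem_nhds huη) hvu' hx)
    rw [sub_self, inner_zero_left] at hmono
    have h0 : ‖u - x‖ ^ 2 = 0 := le_antisymm (nonpos_of_mul_nonpos_right hmono hσ) (sq_nonneg _)
    rw [sq_eq_zero_iff, norm_eq_zero, sub_eq_zero] at h0
    rwa [← h0]
  refine ⟨hlsc, hb, Metric.ball a η, Metric.ball_mem_nhds a hη, Metric.ball b ζ,
    Metric.ball_mem_nhds b hζ0, convex_ball _ _, convex_ball _ _, ψ,
    ⟨⟨a, (hle a haη).trans_lt hb.1⟩, hψbot⟩, lowerSemicontinuous_quadraticEnvelope φ W σ, hconv,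
    fun x hx => hle x (hUs hx), ε, hε, ?_, ?_⟩
  · ext p
    constructor
    · rintro ⟨⟨h1, -, h2⟩, h3⟩
      exact ⟨⟨h1, h2⟩, hsub _ _ ⟨hUs h1, hVs h2, h3⟩⟩
    · rintro ⟨⟨h1, h2⟩, h3⟩
      obtain ⟨h4, h5, h6⟩ := hmax _ _ h1 h2 h3
      exact ⟨⟨h1, hlt _ h4 _ h5 h6, h2⟩, h6⟩
  · rintro p ⟨⟨h1, h2⟩, h3⟩
    exact heq _ _ (hmax _ _ h1 h2 h3)

theorem varStrongConvexAt_of_le_inner {φ : H → EReal} (hbot : ∀ x, φ x ≠ ⊥) {a b : H} {σ : ℝ}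
    (hσ : 0 < σ) (hcont : SubdiffContinuousAt φ a b) (hprox : ProxRegularAt φ a b)
    {U V : Set H} (hU : U ∈ 𝓝 a) (hV : V ∈ 𝓝 b)
    (hcod : ∀ x ∈ U, ∀ y ∈ V, y ∈ limSubdiff φ x → ∀ w, ∀ z ∈ combinedSubdiff2 φ x y w,
      σ * ‖w‖ ^ 2 ≤ inner ℝ z w) :
    VarStrongConvexAt φ a b σ := by
  obtain ⟨δ₀, r, hδ₀, hr, hgrow⟩ := hprox.exists_growth hcont
  obtain ⟨δ₁, hδ₁, hU₁⟩ := exists_closedBall_subset_interior hU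
  obtain ⟨δ₂, hδ₂, hV₂⟩ := exists_closedBall_subset_interior hV
  -- Any positive level works here; 1 is used as the `ε` of variational strong convexity.
  obtain ⟨δ₃, hδ₃, hlt⟩ := hcont.2 1 one_pos
  set δ := min (min δ₀ δ₃) (min δ₁ δ₂) with hδ
  have hδ0 : 0 < δ := by positivity
  have hball : ∀ {γ : ℝ} (c : H), δ ≤ γ → Metric.closedBall c δ ⊆ Metric.closedBall c γ :=
    fun _ h => Metric.closedBall_subset_closedBall h
  have h0 : δ ≤ δ₀ := (min_le_left _ _).trans (min_le_left _ _)
  have h1 : δ ≤ δ₁ := (min_le_right _ _).trans (min_le_left _ _)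
  have h2 : δ ≤ δ₂ := (min_le_right _ _).trans (min_le_right _ _)
  have h3 : δ ≤ δ₃ := (min_le_left _ _).trans (min_le_right _ _)
  obtain ⟨η, hη, hηδ, hη1⟩ := exists_quadratic_growth_of_le_inner hprox.1 hbot hσ hr hδ0 hprox.2.1
    (fun x hx u hu v hv => hgrow x (hball a h0 hx) u (hball a h0 hu) v (hball b h0 hv))
    (fun x hx y hy => hcod x (interior_subset (hU₁ (hball a h1 hx))) y
      (interior_subset (hV₂ (hball b h2 hy))))
  refine varStrongConvexAt_of_quadratic_growth hprox.1 hbot hσ one_pos hη hprox.2.1 ?_ hη1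
  exact fun x hx v hv hvx => (hlt x (Metric.closedBall_subset_closedBall (hηδ.trans h3) hx) v
    (Metric.closedBall_subset_closedBall (hηδ.trans h3) hv) hvx).1

end Envelope

end VarAnalysis

/-! ### The equivalence. -/

theorem theorem5p4 (n : ℕ) (φ : EuclideanSpace ℝ (Fin n) → EReal)
    (hφ : VarAnalysis.IsProper φ)
    (xbar vbar : EuclideanSpace ℝ (Fin n))
    (hx : xbar ∈ VarAnalysis.dom φ) (hv : vbar ∈ VarAnalysis.limSubdiff φ xbar)
    (hcont : VarAnalysis.SubdiffContinuousAt φ xbar vbar)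
    (σ : ℝ) (hσ : 0 < σ) :
    List.TFAE [
      VarAnalysis.VarStrongConvexAt φ xbar vbar σ,
      VarAnalysis.ProxRegularAt φ xbar vbar ∧
        ∃ U ∈ 𝓝 xbar, ∃ V ∈ 𝓝 vbar, ∀ x ∈ U, ∀ y ∈ V, y ∈ VarAnalysis.limSubdiff φ x →
          ∀ w, ∀ z ∈ VarAnalysis.combinedSubdiff2 φ x y w, σ * ‖w‖ ^ 2 ≤ inner ℝ z w,
      VarAnalysis.ProxRegularAt φ xbar vbar ∧
        ∃ U ∈ 𝓝 xbar, ∃ V ∈ 𝓝 vbar, ∀ x ∈ U, ∀ y ∈ V, y ∈ VarAnalysis.limSubdiff φ x →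
          ∀ w, ∀ z ∈ VarAnalysis.limSubdiff2 φ x y w, σ * ‖w‖ ^ 2 ≤ inner ℝ z w] := by
  tfae_have 1 → 2 := fun h =>
    ⟨h.proxRegularAt hσ.le, h.exists_le_inner_of_mem_combinedSubdiff2 hσ hcont⟩
  tfae_have 2 → 1 := fun ⟨hprox, U, hU, V, hV, hcod⟩ =>
    VarAnalysis.varStrongConvexAt_of_le_inner hφ.2 hσ hcont hprox hU hV hcod
  -- Interiors are neighborhoods of each of their points, so they eventually contain the sequences
  -- that define limiting normals.
  tfae_have 2 → 3 := fun ⟨hprox, U, hU, V, hV, hcod⟩ =>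
    ⟨hprox, interior U, interior_mem_nhds.2 hU, interior V, interior_mem_nhds.2 hV,
      fun _ hx _ hy _ _ _ hz => VarAnalysis.le_inner_of_mem_limCoderiv hcod
        (mem_interior_iff_mem_nhds.1 hx) (mem_interior_iff_mem_nhds.1 hy) hz⟩
  tfae_have 3 → 2 := fun ⟨hprox, U, hU, V, hV, hcod⟩ =>
    ⟨hprox, U, hU, V, hV, fun x hx y hy hyx w z hz =>
      hcod x hx y hy hyx w z (VarAnalysis.regNormalCone_subset_limNormalCone _ _ hz)⟩
  tfae_finish
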